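/- Let $X$ be a compact connected nonpositively curved cube complex, and let $\{f_i : A_i \to X\}_{i=1}^n$ be a finite collection of local isometries, where each $A_i$ is a compact connected nonpositively curved cube complex. (A local isometry is a combinatorial map that embeds the link of each $0$-cube as a full subcomplex of the link of its image.) Suppose that $X$ has a finite connected cover $\widehat X\to X$ such that 1. for each immersed hyperplane $U\to\widehat X$, the carrier $N(U)$ is a product $N(U)\cong U\times[-\tfrac12,\tfrac12]$ (that is, $U$ is two-sided) and the map $N(U)\to\widehat X$ is an embedding; here $U=\operatorname{Stab}(\widetilde U)\backslash\widetilde U$ and $N(U)=\operatorname{Stab}(\widetilde U)\backslash N(\widetilde U)$ for a hyperplane $\widetilde U$, with carrier $N(\widetilde U)$, of the universal cover of $\widehat X$, where $\operatorname{Stab}(\widetilde U)$ is its stabilizer in the group of deck transformations; 2. for each $i$, every elevation of $f_i$ to $\widehat X$ is an embedding; here an elevation is a map $\widehat A_i\to\widehat X$, where $\widehat A_i\to A_i$ is a connected cover, such that the compositions $\widehat A_i\to A_i\to X$ and $\widehat A_i\to\widehat X\to X$ agree and, for compatible base points, $\pi_1\widehat A_i$ is the preimage of $\pi_1\widehat X$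 in $\pi_1A_i$. For each $i$, regard $\pi_1A_i$ as a subgroup of $\pi_1X$, namely the image of $(f_i)_*$ for any choice of base points and of a path connecting them. Then $(\pi_1X,\{\pi_1A_i\}_{i=1}^n)$ has finite stature: for each $H\in\{\pi_1A_1,\dots,\pi_1A_n\}$, there are only finitely many $H$-conjugacy classes of infinite subgroups of the form $H\cap C$, where $C$ is an intersection of (possibly infinitely many) $\pi_1X$-conjugates of the subgroups $\pi_1A_1,\dots,\pi_1A_n$. -/

import Mathlib

universe u

/-- A morphism from the `m`-cube to the `n`-cube: an isometric embedding of vertex sets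
`{0,1}^m → {0,1}^n`.  These are exactly the identifications of the `m`-cube with an
`m`-dimensional subcube of the `n`-cube; for `m = n` they are the symmetries of the `n`-cube. -/
@[ext]
structure CubeHom (m n : ℕ) where
  toFun : (Fin m → Bool) → (Fin n → Bool)
  isometry : ∀ x y, hammingDist (toFun x) (toFun y) = hammingDist x y

namespace CubeHom

def id (n : ℕ) : CubeHom n n := ⟨fun x => x, fun _ _ => rfl⟩

def comp {k m n : ℕ} (g : CubeHom m n) (f : CubeHom k m) : CubeHom k n :=
  ⟨fun x => g.toFun (f.toFun x), fun x y => by rw [g.isometry, f.isometry]⟩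

/-- The vertex `x` of the `n`-cube. -/
def vertex {n : ℕ} (x : Fin n → Bool) : CubeHom 0 n :=
  ⟨fun _ => x, fun a b => by rw [Subsingleton.elim a b, hammingDist_self, hammingDist_self]⟩

theorem hammingDist_update_not {n : ℕ} (x : Fin n → Bool) (i : Fin n) :
    hammingDist x (Function.update x i (!x i)) = 1 := by
  unfold hammingDist
  rw [Finset.card_eq_one]
  refine ⟨i, ?_⟩
  ext j
  by_cases h : j = i
  · subst h; simp
  · simp [h]

/-- The edge of the `n`-cube that leaves the vertex `x` in the `i`-th coordinate direction. -/
def edge {n : ℕ} (x : Fin n → Bool) (i : Fin n) : CubeHom 1 n where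
  toFun t := if t 0 then Function.update x i (!x i) else x
  isometry s t := by
    have key : hammingDist s t = if s 0 = t 0 then 0 else 1 := by
      unfold hammingDist
      by_cases h : s 0 = t 0 <;> simp [h, Finset.filter_singleton]
    rw [key]
    cases hs : s 0 <;> cases ht : t 0 <;>
      simp [hammingDist_update_not, hammingDist_comm _ x]

/-- The symmetry of the `n`-cube that reverses all coordinates. -/
def flip (n : ℕ) : CubeHom n n :=
  ⟨fun x i => !x i, fun _ _ => hammingDist_comp (fun _ => not) (fun _ => Bool.not_injective)⟩

end CubeHom

/-- A cube complex, given by its cubes and the way they are glued along subcubes.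
`cube n` is the set of *parametrized* `n`-cubes, that is, of characteristic maps
`[-1/2,1/2]^n → X`; `map f c` is the restriction of the parametrized cube `c` along `f`.
Thus the `n`-cells of the complex are the orbits of the symmetry group of the `n`-cube on `cube n`;
`free` says that no cube is glued to itself by a nontrivial symmetry, so that open cubes embed. -/
structure CubeComplex where
  cube : ℕ → Type u
  map : ∀ {m n : ℕ}, CubeHom m n → cube n → cube m
  map_id : ∀ {n : ℕ} (c : cube n), map (CubeHom.id n) c = c
  map_comp : ∀ {k m n : ℕ} (g : CubeHom m n) (f : CubeHom k m) (c : cube n),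
    map (g.comp f) c = map f (map g c)
  free : ∀ {n : ℕ} (s : CubeHom n n) (c : cube n), map s c = c → s = CubeHom.id n

namespace CubeComplex

variable (X : CubeComplex.{u})

/-- The 0-cubes. -/
abbrev Vertex : Type u := X.cube 0

/-- The parametrized 1-cubes, that is, the edges with a choice of direction. -/
abbrev Dart : Type u := X.cube 1

variable {X}

/-- The vertex of the cube `c` at the vertex `x` of the standard cube. -/
def corner {n : ℕ} (c : X.cube n) (x : Fin n → Bool) : X.Vertex := X.map (CubeHom.vertex x) c

/-- The edge of the cube `c` that leaves `corner c x` in the `i`-th coordinate direction. -/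
def edge {n : ℕ} (c : X.cube n) (x : Fin n → Bool) (i : Fin n) : X.Dart :=
  X.map (CubeHom.edge x i) c

def origin {n : ℕ} (c : X.cube n) : X.Vertex := corner c (fun _ => false)

/-- The edges of `c` at its origin.  The `n`-cubes `c` with `origin c = v` are the
`(n-1)`-simplices of the link of `v` with an ordering of their vertices, and `axis c` is the list
of the vertices; the vertices of the link of `v` are the darts with source `v`. -/
def axis {n : ℕ} (c : X.cube n) (i : Fin n) : X.Dart := edge c (fun _ => false) i

def src (d : X.Dart) : X.Vertex := corner d (fun _ => false)

def tgt (d : X.Dart) : X.Vertex := corner d (fun _ => true)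

/-- The same edge in the opposite direction. -/
def rev (d : X.Dart) : X.Dart := X.map (CubeHom.flip 1) d

theorem rev_rev (d : X.Dart) : rev (rev d) = d := by
  unfold rev
  rw [← X.map_comp]
  conv_rhs => rw [← X.map_id d]
  congr 1
  ext t i
  simp [CubeHom.comp, CubeHom.flip, CubeHom.id]

theorem corner_map {m n : ℕ} (f : CubeHom m n) (c : X.cube n) (x : Fin m → Bool) :
    corner (X.map f c) x = corner c (f.toFun x) := by
  unfold corner
  rw [← X.map_comp]
  rfl

theorem src_rev (d : X.Dart) : src (rev d) = tgt d := corner_map _ _ _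

theorem tgt_rev (d : X.Dart) : tgt (rev d) = src d := corner_map _ _ _

variable (X)

/-- Nonpositive curvature: the link of each vertex is a flag simplicial complex. -/
structure IsNPC : Prop where
  /-- the vertices of a simplex of a link are distinct -/
  axis_injective : ∀ {n : ℕ} (c : X.cube n), Function.Injective (axis c)
  /-- a simplex of a link is determined by its vertices -/
  eq_of_axis_eq : ∀ {n : ℕ} (c c' : X.cube n), origin c = origin c' → axis c = axis c' → c = c'
  /-- pairwise adjacent vertices of a link span a simplex -/
  flag : ∀ (v : X.Vertex) {n : ℕ} (d : Fin n → X.Dart), (∀ i, src (d i) = v) →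
    (∀ i j, i ≠ j → ∃ s : X.cube 2, axis s 0 = d i ∧ axis s 1 = d j) →
    ∃ c : X.cube n, origin c = v ∧ axis c = d

/-- A cube complex is compact if and only if it has finitely many cubes. -/
def IsCompactComplex : Prop := Finite (Σ n, X.cube n)

variable {X}

/-! ### Edge paths and the fundamental group -/

/-- The list of darts `l` is an edge path from `v` to `w`. -/
def IsWalk : X.Vertex → List X.Dart → X.Vertex → Prop
  | v, [], w => v = w
  | v, d :: l, w => src d = v ∧ IsWalk (tgt d) l w

theorem isWalk_append {v w : X.Vertex} (l l' : List X.Dart) :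
    IsWalk v (l ++ l') w ↔ ∃ z, IsWalk v l z ∧ IsWalk z l' w := by
  induction l generalizing v with
  | nil => simp [IsWalk]
  | cons d l ih => simp [IsWalk, ih, and_assoc]

/-- The reverse of an edge path. -/
def revList (l : List X.Dart) : List X.Dart := (l.map rev).reverse

theorem revList_append (l l' : List X.Dart) : revList (l ++ l') = revList l' ++ revList l := by
  simp [revList]

theorem IsWalk.revList {v w : X.Vertex} {l : List X.Dart} (h : IsWalk v l w) :
    IsWalk w (revList l) v := by
  induction l generalizing v with
  | nil => exact (show v = w from h).symm
  | cons d l ih =>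
    have : CubeComplex.revList (d :: l) = CubeComplex.revList l ++ [rev d] := by
      simp [CubeComplex.revList]
    rw [this, isWalk_append]
    exact ⟨_, ih h.2, src_rev d, (tgt_rev d).trans h.1⟩

/-- Elementary homotopies of edge paths: removing a backtrack, and pushing a path of two edges
across a square. -/
inductive Move : List X.Dart → List X.Dart → Prop
  | backtrack (l l' : List X.Dart) (d : X.Dart) : Move (l ++ [d, rev d] ++ l') (l ++ l')
  | square (l l' : List X.Dart) (s : X.cube 2) :
    Move (l ++ [edge s ![false, false] 0, edge s ![true, false] 1] ++ l')
      (l ++ [edge s ![false, false] 1, edge s ![false, true] 0] ++ l')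

theorem Move.append_left {l l' : List X.Dart} (k : List X.Dart) (h : Move l l') :
    Move (k ++ l) (k ++ l') := by
  cases h with
  | backtrack a b d => simpa [List.append_assoc] using Move.backtrack (k ++ a) b d
  | square a b s => simpa [List.append_assoc] using Move.square (k ++ a) b s

theorem Move.append_right {l l' : List X.Dart} (k : List X.Dart) (h : Move l l') :
    Move (l ++ k) (l' ++ k) := by
  cases h with
  | backtrack a b d => simpa [List.append_assoc] using Move.backtrack a (b ++ k) d
  | square a b s => simpa [List.append_assoc] using Move.square a (b ++ k) s

theorem rev_edge_eq (s : X.cube 2) (f : CubeHom 2 2) (x y : Fin 2 → Bool) (i j : Fin 2)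
    (h : ∀ t, ((CubeHom.edge x i).comp (CubeHom.flip 1)).toFun t
      = (f.comp (CubeHom.edge y j)).toFun t) :
    rev (edge s x i) = edge (X.map f s) y j := by
  unfold rev edge
  rw [← X.map_comp, ← X.map_comp]
  congr 1
  ext t
  rw [h t]

theorem Move.revList {l l' : List X.Dart} (h : Move l l') :
    Move (revList l) (CubeComplex.revList l') ∨ Move (CubeComplex.revList l') (revList l) := by
  cases h with
  | backtrack a b d =>
    left
    have := Move.backtrack (CubeComplex.revList b) (CubeComplex.revList a) d
    simpa [CubeComplex.revList, rev_rev] using this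
  | square a b s =>
    right
    have := Move.square (CubeComplex.revList b) (CubeComplex.revList a) (X.map (CubeHom.flip 2) s)
    rw [← rev_edge_eq s (CubeHom.flip 2) ![true, false] ![false, false] 1 1 (by decide),
      ← rev_edge_eq s (CubeHom.flip 2) ![false, false] ![false, true] 0 0 (by decide),
      ← rev_edge_eq s (CubeHom.flip 2) ![false, true] ![false, false] 0 0 (by decide),
      ← rev_edge_eq s (CubeHom.flip 2) ![false, false] ![true, false] 1 1 (by decide)] at this
    simpa [CubeComplex.revList] using this

/-- Edge paths from `v` to `w`. -/
abbrev Walk (v w : X.Vertex) : Type u := {l : List X.Dart // IsWalk v l w}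

/-- Homotopy classes (relative to the end points) of edge paths from `v` to `w`: the quotient of the
edge paths by the equivalence relation generated by the elementary homotopies. -/
def PathClass (v w : X.Vertex) : Type u := Quot fun p q : Walk v w => Move p.1 q.1

namespace PathClass

def mk {v w : X.Vertex} (l : List X.Dart) (h : IsWalk v l w) : PathClass v w := Quot.mk _ ⟨l, h⟩

theorem sound {v w : X.Vertex} {l l' : List X.Dart} (h : IsWalk v l w) (h' : IsWalk v l' w)
    (m : Move l l') : mk l h = mk l' h' := Quot.sound m

theorem ind {v w : X.Vertex} {P : PathClass v w → Prop} (h : ∀ l hl, P (mk l hl))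
    (g : PathClass v w) : P g := Quot.ind (fun p => h p.1 p.2) g

/-- The class of the constant path. -/
def refl (v : X.Vertex) : PathClass v v := mk [] rfl

/-- Concatenation. -/
def comp {u v w : X.Vertex} : PathClass u v → PathClass v w → PathClass u w :=
  Quot.map₂ (fun p q => ⟨p.1 ++ q.1, (isWalk_append _ _).2 ⟨v, p.2, q.2⟩⟩)
    (fun p _ _ h => h.append_left p.1) (fun _ _ q h => h.append_right q.1)

/-- The class of the reverse path. -/
def symm {v w : X.Vertex} : PathClass v w → PathClass w v :=
  Quot.lift (fun p => mk (revList p.1) p.2.revList) fun p q h => by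
    rcases Move.revList h with h | h
    · exact sound _ _ h
    · exact (sound _ _ h).symm

theorem comp_assoc {u v w z : X.Vertex} (f : PathClass u v) (g : PathClass v w)
    (h : PathClass w z) : (f.comp g).comp h = f.comp (g.comp h) := by
  induction f using ind
  induction g using ind
  induction h using ind
  exact congrArg (Quot.mk _) (Subtype.ext (List.append_assoc _ _ _))

theorem refl_comp {v w : X.Vertex} (f : PathClass v w) : (refl v).comp f = f := by
  induction f using ind
  rfl

theorem comp_refl {v w : X.Vertex} (f : PathClass v w) : f.comp (refl w) = f := by
  induction f using ind
  exact congrArg (Quot.mk _) (Subtype.ext (List.append_nil _))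

theorem symm_comp {v w : X.Vertex} (f : PathClass v w) : f.symm.comp f = refl w := by
  induction f using ind with
  | h l hl =>
    induction l generalizing v with
    | nil =>
      have hl' : v = w := hl
      subst hl'
      rfl
    | cons d l ih =>
      rw [← ih hl.2]
      have m := Move.backtrack (revList l) l (rev d)
      rw [rev_rev] at m
      refine sound _ _ ?_
      simpa [revList] using m

theorem symm_symm {v w : X.Vertex} (f : PathClass v w) : f.symm.symm = f := by
  induction f using ind with
  | h l hl =>
    refine congrArg (Quot.mk _) (Subtype.ext ?_)
    have : (rev ∘ rev : X.Dart → X.Dart) = _root_.id := funext rev_rev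
    simp [revList, this]

theorem comp_symm {v w : X.Vertex} (f : PathClass v w) : f.comp f.symm = refl v := by
  have := symm_comp f.symm
  rwa [symm_symm] at this

end PathClass

/-- The fundamental group of `X` at `v`, as the edge-path group. -/
abbrev Pi1 (X : CubeComplex.{u}) (v : X.Vertex) : Type u := PathClass v v

instance (v : X.Vertex) : Group (X.Pi1 v) where
  mul := PathClass.comp
  one := PathClass.refl v
  inv := PathClass.symm
  mul_assoc := PathClass.comp_assoc
  one_mul := PathClass.refl_comp
  mul_one := PathClass.comp_refl
  inv_mul_cancel := PathClass.symm_comp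

/-- Change of base point along a path class. -/
def changeBase {v w : X.Vertex} (g : PathClass v w) : X.Pi1 v →* X.Pi1 w where
  toFun a := (g.symm.comp a).comp g
  map_one' := by
    change (g.symm.comp (PathClass.refl v)).comp g = PathClass.refl w
    rw [PathClass.comp_refl, PathClass.symm_comp]
  map_mul' a b := by
    change (g.symm.comp (PathClass.comp a b)).comp g
      = PathClass.comp ((g.symm.comp a).comp g) ((g.symm.comp b).comp g)
    have h : g.comp (g.symm.comp (PathClass.comp b g)) = PathClass.comp b g := by
      rw [← PathClass.comp_assoc, PathClass.comp_symm, PathClass.refl_comp]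
    simp only [PathClass.comp_assoc, h]

variable (X)

/-- Connected (in particular nonempty). -/
def IsConnected : Prop := Nonempty X.Vertex ∧ ∀ v w : X.Vertex, Nonempty (PathClass v w)

def IsSimplyConnected : Prop := X.IsConnected ∧ ∀ v : X.Vertex, Subsingleton (X.Pi1 v)

end CubeComplex

open CubeComplex

/-- Combinatorial maps: each `n`-cube is mapped isomorphically to an `n`-cube. -/
@[ext]
structure CubeMap (Y X : CubeComplex.{u}) where
  toFun : ∀ {n : ℕ}, Y.cube n → X.cube n
  naturality : ∀ {m n : ℕ} (f : CubeHom m n) (c : Y.cube n), toFun (Y.map f c) = X.map f (toFun c)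

namespace CubeMap

variable {X Y Z : CubeComplex.{u}}

def comp (g : CubeMap Y X) (f : CubeMap Z Y) : CubeMap Z X :=
  ⟨fun c => g.toFun (f.toFun c), fun s c => by rw [f.naturality, g.naturality]⟩

theorem isWalk (φ : CubeMap Y X) {v w : Y.Vertex} {l : List Y.Dart} (h : IsWalk v l w) :
    IsWalk (φ.toFun v) (l.map φ.toFun) (φ.toFun w) := by
  induction l generalizing v with
  | nil => exact congrArg φ.toFun (show v = w from h)
  | cons d l ih =>
    refine ⟨?_, ?_⟩
    · rw [← h.1]
      exact (φ.naturality _ _).symm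
    · have := ih h.2
      rwa [show φ.toFun (tgt d) = tgt (φ.toFun d) from φ.naturality _ _] at this

theorem move (φ : CubeMap Y X) {l l' : List Y.Dart} (h : Move l l') :
    Move (l.map φ.toFun) (l'.map φ.toFun) := by
  cases h with
  | backtrack a b d =>
    have := Move.backtrack (a.map φ.toFun) (b.map φ.toFun) (φ.toFun d)
    simpa [rev, φ.naturality] using this
  | square a b s =>
    have := Move.square (a.map φ.toFun) (b.map φ.toFun) (φ.toFun s)
    simpa [edge, φ.naturality] using this

/-- The homomorphism `π₁(Y,v) → π₁(X,w)` induced by a map with `φ(v) = w`. -/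
def pi1Map (φ : CubeMap Y X) {v : Y.Vertex} {w : X.Vertex} (hv : φ.toFun v = w) :
    Y.Pi1 v →* X.Pi1 w where
  toFun := Quot.map (fun p => ⟨p.1.map φ.toFun, hv ▸ φ.isWalk p.2⟩) fun _ _ h => φ.move h
  map_one' := rfl
  map_mul' a b := by
    induction a using PathClass.ind
    induction b using PathClass.ind
    exact congrArg (Quot.mk _) (Subtype.ext List.map_append)

/-- The subgroup `π₁Y` of `π₁(X,w)`, for base point `v` of `Y` and a path class `g` from `φ(v)`
to `w`. -/
def pi1Image (φ : CubeMap Y X) (v : Y.Vertex) {w : X.Vertex} (g : PathClass (φ.toFun v) w) :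
    Subgroup (X.Pi1 w) :=
  ((changeBase g).comp (φ.pi1Map (v := v) rfl)).range

/-- Local isometries: the induced maps of links are injective with full image. -/
structure IsLocalIsometry (φ : CubeMap Y X) : Prop where
  link_injective : ∀ d d' : Y.Dart, src d = src d' → φ.toFun d = φ.toFun d' → d = d'
  link_full : ∀ (v : Y.Vertex) {n : ℕ} (d : Fin n → Y.Dart), (∀ i, src (d i) = v) →
    (∃ c : X.cube n, origin c = φ.toFun v ∧ ∀ i, axis c i = φ.toFun (d i)) →
    ∃ c : Y.cube n, origin c = v ∧ axis c = d

/-- Embeddings: injective on cubes. -/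
def IsEmbedding (φ : CubeMap Y X) : Prop :=
  ∀ n : ℕ, Function.Injective (φ.toFun : Y.cube n → X.cube n)

/-- Covering maps: the induced maps of links are isomorphisms. -/
def IsCovering (p : CubeMap Y X) : Prop :=
  ∀ (y : Y.Vertex) {n : ℕ} (c : X.cube n), origin c = p.toFun y →
    ∃! c' : Y.cube n, origin c' = y ∧ p.toFun c' = c

def HasFiniteFibres (p : CubeMap Y X) : Prop :=
  ∀ x : X.Vertex, {y : Y.Vertex | p.toFun y = x}.Finite

def IsUniversalCover (p : CubeMap Y X) : Prop := p.IsCovering ∧ Y.IsSimplyConnected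

/-- Deck transformations of `p`. -/
def IsDeck (p : CubeMap Y X) (g : CubeMap Y Y) : Prop :=
  (∀ n : ℕ, Function.Bijective (g.toFun : Y.cube n → Y.cube n)) ∧ p.comp g = p

/-- `f' : B → X'` is an elevation of `f : A → X` to the cover `p : X' → X`, where `q : B → A` is the
covering map that belongs to it: `B` is connected, the square commutes, and `π₁B` is the preimage
of `π₁X'` in `π₁A`. -/
structure IsElevation {A B X X' : CubeComplex.{u}} (f : CubeMap A X) (p : CubeMap X' X)
    (q : CubeMap B A) (f' : CubeMap B X') : Prop where
  connected : B.IsConnected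
  covering : q.IsCovering
  comm : p.comp f' = f.comp q
  pi1_eq : ∀ (b : B.Vertex) (h : p.toFun (f'.toFun b) = f.toFun (q.toFun b)),
    (q.pi1Map (v := b) rfl).range
      = (p.pi1Map (v := f'.toFun b) h).range.comap (f.pi1Map (v := q.toFun b) rfl)

end CubeMap

namespace CubeComplex

variable {X : CubeComplex.{u}}

/-! ### Hyperplanes and carriers -/

/-- The equivalence relation on directed edges generated by being opposite, with the same
direction, in a square. -/
def DirParallel : X.Dart → X.Dart → Prop :=
  Relation.EqvGen fun d d' =>
    ∃ s : X.cube 2, edge s ![false, false] 0 = d ∧ edge s ![false, true] 0 = d'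

/-- Two edges are parallel (as undirected edges) if they are dual to the same hyperplane.
Accordingly a hyperplane is given by an edge `d`: it consists of the midcubes dual to the
edges parallel to `d`. -/
def Parallel (d d' : X.Dart) : Prop := DirParallel d d' ∨ DirParallel d (rev d')

/-- The cube `c` belongs to the carrier of the hyperplane dual to `d`: it is a face of a cube
that the hyperplane crosses. -/
def InCarrier (d : X.Dart) {n : ℕ} (c : X.cube n) : Prop :=
  ∃ (m : ℕ) (b : X.cube m) (f : CubeHom n m), X.map f b = c ∧
    ∃ (x : Fin m → Bool) (i : Fin m), Parallel d (edge b x i)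

/-- For each immersed hyperplane `U → X`, the carrier `N(U)` is a product `U × [-1/2,1/2]`
and the map `N(U) → X` is an embedding.  Here `U` and `N(U)` are the quotients of a hyperplane of
the universal cover, and of its carrier, by the stabilizer of the hyperplane in the group of deck
transformations.  Injectivity says that two cubes of the carrier with the same image differ by an
element of the stabilizer; the carrier is a product if the stabilizer does not exchange the two
sides of the hyperplane. -/
def HasEmbeddedCarriers (X : CubeComplex.{u}) : Prop :=
  ∀ (Y : CubeComplex.{u}) (p : CubeMap Y X), p.IsUniversalCover → ∀ d : Y.Dart,
    (∀ (n : ℕ) (c c' : Y.cube n), InCarrier d c → InCarrier d c' → p.toFun c = p.toFun c' →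
      ∃ g : CubeMap Y Y, p.IsDeck g ∧ Parallel d (g.toFun d) ∧ g.toFun c = c') ∧
    (∀ g : CubeMap Y Y, p.IsDeck g → Parallel d (g.toFun d) → DirParallel d (g.toFun d))

end CubeComplex

/-- Finite stature of a group `G` with respect to a family of subgroups: for each `H` in the family,
there are finitely many `H`-conjugacy classes of infinite subgroups of the form `H ∩ C`, where `C`
is the intersection of a (possibly infinite) set of conjugates of members of the family. -/
def FiniteStature {G : Type*} [Group G] {ι : Type*} (Ω : ι → Subgroup G) : Prop :=
  ∀ i : ι,
    ((fun K : Subgroup G => {K' : Subgroup G | ∃ h ∈ Ω i, K' = K.map (MulAut.conj h).toMonoidHom}) ''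
      {K : Subgroup G | (K : Set G).Infinite ∧ ∃ S : Set (G × ι),
        K = Ω i ⊓ ⨅ s ∈ S, (Ω s.2).map (MulAut.conj s.1).toMonoidHom}).Finite

/-! Fix a covering `π` from the universal cover of `X` to the finite cover `X'`. Every conjugate of
`π₁A_j` preserves a convex subcomplex of the universal cover, a translate of a lift of the universal
cover of `A_j`. As elevations to `X'` embed, this subcomplex is a component of the `π`-preimage of a
set `B` of edges of `X'` that is closed under completing squares. A deck transformation over `X'`
that moves the base point of the subcomplex within the subcomplex lies in the conjugate
(`exists_convexSet_of_conj`). There are only finitely many sets `B`, since `X'` has finitely many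
edges.

To intersect stabilizers, join the subcomplexes of two convex sets `Q` and `B` by a shortest edge
path `γ`, and keep the edges of `Q` that can be pushed across all hyperplanes dual to `γ` into `B`.
The carrier hypothesis makes this a condition on edges of `X'`: at a vertex, a hyperplane has at
most one dual edge on a given side (`hasNoSelfOsculation`). The result is a convex set `Q₂ ⊆ Q`. A
map preserving both subcomplexes preserves one component of the preimage of `Q₂`, and deck
transformations over `X'` that preserve this component preserve the subcomplex of `B`
(`exists_parallel_part`).

For an intersection `K` of `H` with conjugates, choose a minimal convex set `Q` with a component
preserved by `K`. Minimality gives `Q₂ = Q` for every conjugate in the intersection, however many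
there are. Hence `K` contains all deck transformations over `X'` that preserve the component of `Q`
(`IsCarriedBy`). Up to conjugation in `H`, such a `K` is determined by `Q`, by the image in `X'` of
a vertex `v` of the component, and by the image in `X'` of the orbit `Kv` (`IsCarriedBy.conj_mem`).
These are finitely many data.

The geometry is done with edge paths instead of metrics or disc diagrams. Homotopic reduced paths
differ only by pushes across squares (`PathClass.eqv_of_mk_eq`). Applied to a quadrilateral with two
sides in convex subcomplexes and two shortest connecting sides, this produces a product region
(`IsConvexSet.exists_slideAll`). -/

namespace CubeComplex

variable {X : CubeComplex.{u}}

/-! ### Squares -/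

/-- The edge paths `a, b` and `c, d` are the two halves of the boundary of a square. -/
def Sq (a b c d : X.Dart) : Prop :=
  ∃ s : X.cube 2, edge s ![false, false] 0 = a ∧ edge s ![true, false] 1 = b ∧
    edge s ![false, false] 1 = c ∧ edge s ![false, true] 0 = d

theorem edge_map {m n : ℕ} (f : CubeHom m n) (c : X.cube n) (x : Fin m → Bool) (i : Fin m)
    (y : Fin n → Bool) (j : Fin n)
    (h : ∀ t, (f.comp (CubeHom.edge x i)).toFun t = (CubeHom.edge y j).toFun t) :
    edge (X.map f c) x i = edge c y j := by
  unfold edge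
  rw [← X.map_comp]
  congr 1
  ext t
  rw [h t]

theorem zero_two : (![false, false] : Fin 2 → Bool) = fun _ => false := by decide

theorem src_edge {n : ℕ} (c : X.cube n) (x : Fin n → Bool) (i : Fin n) :
    src (edge c x i) = corner c x := by
  unfold src edge
  rw [corner_map]
  simp [CubeHom.edge]

theorem tgt_edge {n : ℕ} (c : X.cube n) (x : Fin n → Bool) (i : Fin n) :
    tgt (edge c x i) = corner c (Function.update x i (!x i)) := by
  unfold tgt edge
  rw [corner_map]
  simp [CubeHom.edge]

theorem rev_edge {n : ℕ} (c : X.cube n) (x : Fin n → Bool) (i : Fin n) :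
    rev (edge c x i) = edge c (Function.update x i (!x i)) i := by
  unfold rev edge
  rw [← X.map_comp]
  congr 1
  ext t j
  cases h : t 0 <;> simp [CubeHom.comp, CubeHom.edge, CubeHom.flip, h]

theorem src_axis {n : ℕ} (c : X.cube n) (i : Fin n) : src (axis c i) = origin c := src_edge _ _ _

/-- Exchanging the coordinates of the square. -/
def squareSwap : CubeHom 2 2 := ⟨fun t => ![t 1, t 0], by decide⟩

/-- Reversing the first coordinate of the square. -/
def squareReflect : CubeHom 2 2 := ⟨fun t => ![!t 0, t 1], by decide⟩

namespace Sq

variable {a b c d b' d' : X.Dart}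

theorem swap (h : Sq a b c d) : Sq c d a b := by
  obtain ⟨s, rfl, rfl, rfl, rfl⟩ := h
  exact ⟨X.map squareSwap s, edge_map _ _ _ _ _ _ (by decide), edge_map _ _ _ _ _ _ (by decide),
    edge_map _ _ _ _ _ _ (by decide), edge_map _ _ _ _ _ _ (by decide)⟩

theorem rotate (h : Sq a b c d) : Sq (rev a) c b (rev d) := by
  obtain ⟨s, rfl, rfl, rfl, rfl⟩ := h
  exact ⟨X.map squareReflect s, (rev_edge_eq _ _ _ _ _ _ (by decide)).symm,
    edge_map _ _ _ _ _ _ (by decide), edge_map _ _ _ _ _ _ (by decide),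
    (rev_edge_eq _ _ _ _ _ _ (by decide)).symm⟩

theorem src_eq (h : Sq a b c d) : src a = src c := by
  obtain ⟨s, rfl, rfl, rfl, rfl⟩ := h
  rw [src_edge, src_edge]

theorem src_right (h : Sq a b c d) : src b = tgt a := by
  obtain ⟨s, rfl, rfl, rfl, rfl⟩ := h
  rw [src_edge, tgt_edge]
  congr 1
  decide

theorem tgt_eq (h : Sq a b c d) : tgt b = tgt d := by
  obtain ⟨s, rfl, rfl, rfl, rfl⟩ := h
  rw [tgt_edge, tgt_edge]
  congr 1
  decide

theorem src_top (h : Sq a b c d) : src d = tgt c := h.swap.src_right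

/-- Reflection of the square in the axis that exchanges `a` and `d`. -/
theorem flipSide (h : Sq a b c d) : Sq d (rev b) (rev c) a := h.swap.rotate.swap

theorem reverse (h : Sq a b c d) : Sq (rev b) (rev a) (rev d) (rev c) := h.rotate.swap.rotate

theorem ne (hX : X.IsNPC) (h : Sq a b c d) : a ≠ c := by
  obtain ⟨s, rfl, rfl, rfl, rfl⟩ := h
  rw [zero_two]
  intro h
  exact absurd (hX.axis_injective s h) (by decide)

theorem rev_ne (hX : X.IsNPC) (h : Sq a b c d) : b ≠ rev a := (h.rotate.ne hX).symm

theorem unique (hX : X.IsNPC) (h : Sq a b c d) (h' : Sq a b' c d') : b = b' ∧ d = d' := by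
  obtain ⟨s, h1, rfl, h3, rfl⟩ := h
  obtain ⟨s', h1', rfl, h3', rfl⟩ := h'
  have : s = s' := by
    apply hX.eq_of_axis_eq
    · rw [← src_axis s 0, ← src_axis s' 0]
      unfold axis
      rw [← zero_two, h1, h1']
    · funext i
      unfold axis
      rw [← zero_two]
      fin_cases i
      · exact h1.trans h1'.symm
      · exact h3.trans h3'.symm
  subst this
  exact ⟨rfl, rfl⟩

/-- A square is determined by one half of its boundary. -/
theorem unique_path (hX : X.IsNPC) (h : Sq a b c d) {c' d' : X.Dart} (h' : Sq a b c' d') :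
    c = c' ∧ d = d' := by
  have := h.rotate.unique hX h'.rotate
  exact ⟨this.1, by rw [← rev_rev d, this.2, rev_rev]⟩

end Sq

/-- The two-dimensional faces of the three-dimensional cube. -/
def cubeFace (k : Fin 3) (ε : Bool) : CubeHom 2 3 :=
  ⟨fun t => ![![ε, t 0, t 1], ![t 0, ε, t 1], ![t 0, t 1, ε]] k, by revert k ε; decide⟩

/-- Three squares that pairwise share an edge at a vertex are the corner of a 3-cube by flagness,
and the new squares are the opposite faces. All later uses of nonpositive curvature beyond
uniqueness of squares go through this statement. -/
theorem exists_sq_of_isNPC (hX : X.IsNPC) {a b c d e f g h i : X.Dart}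
    (hac : Sq a b c d) (hae : Sq a f e g) (hce : Sq c h e i) :
    ∃ j k l, Sq b j f k ∧ Sq d j h l ∧ Sq g k i l := by
  have key : ∀ {a b c d : X.Dart}, Sq a b c d → ∃ s : X.cube 2, axis s 0 = a ∧ axis s 1 = c := by
    rintro a b c d ⟨s, h1, -, h3, -⟩
    rw [zero_two] at h1 h3
    exact ⟨s, h1, h3⟩
  obtain ⟨q, hq, hax⟩ := hX.flag (src a) ![a, c, e]
    (by
      intro i
      fin_cases i
      · rfl
      · exact hac.src_eq.symm
      · exact hae.src_eq.symm)
    (by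
      intro i j hij
      fin_cases i <;> fin_cases j
      · exact absurd rfl hij
      · exact key hac
      · exact key hae
      · exact key hac.swap
      · exact absurd rfl hij
      · exact key hce
      · exact key hae.swap
      · exact key hce.swap
      · exact absurd rfl hij)
  have e3 : (![false, false, false] : Fin 3 → Bool) = fun _ => false := by decide
  have h0 : edge q ![false, false, false] 0 = a := by rw [e3]; exact congrFun hax 0
  have h1 : edge q ![false, false, false] 1 = c := by rw [e3]; exact congrFun hax 1
  have h2 : edge q ![false, false, false] 2 = e := by rw [e3]; exact congrFun hax 2
  have s01 : Sq a (edge q ![true, false, false] 1) c (edge q ![false, true, false] 0) :=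
    ⟨X.map (cubeFace 2 false) q, h0 ▸ edge_map _ _ _ _ _ _ (by decide),
      edge_map _ _ _ _ _ _ (by decide), h1 ▸ edge_map _ _ _ _ _ _ (by decide),
      edge_map _ _ _ _ _ _ (by decide)⟩
  have s02 : Sq a (edge q ![true, false, false] 2) e (edge q ![false, false, true] 0) :=
    ⟨X.map (cubeFace 1 false) q, h0 ▸ edge_map _ _ _ _ _ _ (by decide),
      edge_map _ _ _ _ _ _ (by decide), h2 ▸ edge_map _ _ _ _ _ _ (by decide),
      edge_map _ _ _ _ _ _ (by decide)⟩
  have s12 : Sq c (edge q ![false, true, false] 2) e (edge q ![false, false, true] 1) :=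
    ⟨X.map (cubeFace 0 false) q, h1 ▸ edge_map _ _ _ _ _ _ (by decide),
      edge_map _ _ _ _ _ _ (by decide), h2 ▸ edge_map _ _ _ _ _ _ (by decide),
      edge_map _ _ _ _ _ _ (by decide)⟩
  obtain ⟨rfl, rfl⟩ := hac.unique hX s01
  obtain ⟨rfl, rfl⟩ := hae.unique hX s02
  obtain ⟨rfl, rfl⟩ := hce.unique hX s12
  refine ⟨edge q ![true, true, false] 2, edge q ![true, false, true] 1,
    edge q ![false, true, true] 0, ⟨X.map (cubeFace 0 true) q, ?_, ?_, ?_, ?_⟩,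
    ⟨X.map (cubeFace 1 true) q, ?_, ?_, ?_, ?_⟩, ⟨X.map (cubeFace 2 true) q, ?_, ?_, ?_, ?_⟩⟩ <;>
  exact edge_map _ _ _ _ _ _ (by decide)

end CubeComplex

namespace CubeComplex

variable {X : CubeComplex.{u}}

/-! ### Equivalence of edge paths under pushing across squares -/

/-- Two edge paths of the same length are equivalent if they are related by pushing paths of length
two across squares. -/
inductive Eqv : List X.Dart → List X.Dart → Prop
  | nil : Eqv [] []
  | cons (a : X.Dart) {w w' : List X.Dart} : Eqv w w' → Eqv (a :: w) (a :: w')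
  | sq {a b c d : X.Dart} {w w' u : List X.Dart} : Sq a b c d → Eqv w (b :: u) →
      Eqv w' (d :: u) → Eqv (a :: w) (c :: w')

namespace Eqv

@[refl]
theorem refl (w : List X.Dart) : Eqv w w := by
  induction w with
  | nil => exact nil
  | cons a w ih => exact cons a ih

@[symm]
theorem symm {w w' : List X.Dart} (h : Eqv w w') : Eqv w' w := by
  induction h with
  | nil => exact nil
  | cons a _ ih => exact cons a ih
  | sq s h1 h2 => exact sq s.swap h2 h1

theorem length_eq {w w' : List X.Dart} (h : Eqv w w') : w.length = w'.length := by
  induction h with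
  | nil => rfl
  | cons a _ ih => simp [ih]
  | sq s h1 h2 ih1 ih2 => simp at *; omega

theorem swap_head {a b c d : X.Dart} (s : Sq a b c d) (w : List X.Dart) :
    Eqv (a :: b :: w) (c :: d :: w) := sq s (refl _) (refl _)

/-- The rule `sq` changes the first edge only once, so transitivity needs an argument. The induction
is on a length bound, because the tails that get compared are not subterms of the given derivations.
-/
theorem trans_aux (hX : X.IsNPC) (n : ℕ) : ∀ {w w' w'' : List X.Dart}, w.length ≤ n → Eqv w w' →
    Eqv w' w'' → Eqv w w'' := by
  induction n with
  | zero =>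
    intro w w' w'' hn h h'
    obtain rfl : w = [] := List.eq_nil_of_length_eq_zero (by omega)
    cases h
    exact h'
  | succ n ih =>
    intro w w' w'' hn h h'
    cases h with
    | nil => exact h'
    | cons a h1 =>
      have l1 := h1.length_eq
      cases h' with
      | cons _ h2 => exact cons a (ih (by simp at hn; omega) h1 h2)
      | sq s h2 h3 => exact sq s (ih (by simp at hn; omega) h1 h2) h3
    | @sq a b c d w w' u s h1 h2 =>
      have l1 := h1.length_eq
      have l2 := h2.length_eq
      simp at hn l1 l2
      cases h' with
      | cons _ h3 => exact sq s h1 (ih (by have := h3.length_eq; omega) h3.symm h2)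
      | @sq _ k e i _ w'' t s' h3 h4 =>
        have l3 := h3.length_eq
        have l4 := h4.length_eq
        simp at l3 l4
        have h5 : Eqv (d :: u) (k :: t) := ih (by simp; omega) h2.symm h3
        cases h5 with
        | cons _ h6 =>
          obtain ⟨rfl, rfl⟩ := s.swap.unique_path hX s'
          exact cons a (ih (by omega) h1 (ih (by simp; omega) (cons b h6) h4.symm))
        | @sq _ j _ l _ _ z s'' h6 h7 =>
          have l6 := h6.length_eq
          have l7 := h7.length_eq
          simp at l6 l7
          -- The three squares meet at the end of `c`. The cube they span has a face with sides `a`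
          -- and `e` at the starting vertex, which exchanges the outer two first edges directly.
          obtain ⟨J, K, L, t1, t2, t3⟩ := exists_sq_of_isNPC hX s.swap.rotate s'.rotate s''
          have t2' := t2.rotate
          have t3' := t3.rotate
          rw [rev_rev] at t2' t3'
          refine sq t1 (u := rev L :: z) ?_ ?_
          · exact ih (by omega) h1 (ih (by simp; omega) (cons b h6) (swap_head t2' z))
          · exact ih (by omega) h4 (ih (by simp; omega) (cons i h7) (swap_head t3' z))

theorem trans (hX : X.IsNPC) {w w' w'' : List X.Dart} (h : Eqv w w') (h' : Eqv w' w'') :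
    Eqv w w'' := trans_aux hX _ le_rfl h h'

theorem append_right {w w' : List X.Dart} (h : Eqv w w') (t : List X.Dart) :
    Eqv (w ++ t) (w' ++ t) := by
  induction h with
  | nil => exact refl _
  | cons a _ ih => exact cons a ih
  | sq s _ _ ih1 ih2 => exact sq s ih1 ih2

theorem append_left {w w' : List X.Dart} (t : List X.Dart) (h : Eqv w w') :
    Eqv (t ++ w) (t ++ w') := by
  induction t with
  | nil => exact h
  | cons a t ih => exact cons a ih

/-- The rule `sq` cannot apply here: the two sides of a square at a corner are distinct vertices of
the link. -/
theorem of_cons (hX : X.IsNPC) {a : X.Dart} {w w' : List X.Dart} (h : Eqv (a :: w) (a :: w')) :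
    Eqv w w' := by
  cases h with
  | cons _ h => exact h
  | sq s _ _ => exact absurd rfl (s.ne hX)

theorem inv {w v : List X.Dart} (h : Eqv w v) : ∀ {a c : X.Dart} {w' v' : List X.Dart}, w = a :: w' →
    v = c :: v' → a ≠ c → ∃ b d u, Sq a b c d ∧ Eqv w' (b :: u) ∧ Eqv v' (d :: u) := by
  rintro a c w' v' rfl rfl hne
  cases h with
  | cons _ h => exact absurd rfl hne
  | sq s h1 h2 => exact ⟨_, _, _, s, h1, h2⟩

theorem revList (hX : X.IsNPC) {w w' : List X.Dart} (h : Eqv w w') :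
    Eqv (revList w) (CubeComplex.revList w') := by
  have rc : ∀ (a : X.Dart) w, CubeComplex.revList (a :: w) = CubeComplex.revList w ++ [rev a] := by
    intro a w; simp [CubeComplex.revList]
  induction h with
  | nil => exact refl _
  | cons a _ ih => rw [rc, rc]; exact ih.append_right _
  | sq s _ _ ih1 ih2 =>
    rw [rc] at ih1 ih2
    rw [rc, rc]
    refine trans hX (ih1.append_right _) (trans hX ?_ (ih2.append_right _).symm)
    rw [List.append_assoc, List.append_assoc]
    exact append_left _ (swap_head s.reverse [])

theorem isWalk {w w' : List X.Dart} (h : Eqv w w') : ∀ {x y : X.Vertex}, IsWalk x w y →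
    IsWalk x w' y := by
  suffices ∀ x y : X.Vertex, IsWalk x w y ↔ IsWalk x w' y from fun {x y} => (this x y).1
  induction h with
  | nil => exact fun _ _ => Iff.rfl
  | cons a _ ih =>
    intro x y
    simp only [IsWalk, ih]
  | sq s _ _ ih1 ih2 =>
    intro x y
    simp only [IsWalk, ih1, ih2, s.src_eq, s.src_right, s.src_top, s.tgt_eq]

end Eqv

theorem revList_cons (a : X.Dart) (w : List X.Dart) : revList (a :: w) = revList w ++ [rev a] := by
  simp [revList]

theorem revList_revList (w : List X.Dart) : revList (revList w) = w := by
  have : (rev ∘ rev : X.Dart → X.Dart) = _root_.id := funext rev_rev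
  simp [revList, this]

theorem length_revList (w : List X.Dart) : (revList w).length = w.length := by
  simp [revList]

/-! ### Reduced edge paths -/

/-- Up to equivalence, the edge path `w` starts with `d`. -/
def Starts (d : X.Dart) (w : List X.Dart) : Prop := ∃ w', Eqv w (d :: w')

theorem Starts.congr (hX : X.IsNPC) {d : X.Dart} {w w' : List X.Dart} (h : Starts d w)
    (e : Eqv w w') : Starts d w' := by
  obtain ⟨t, ht⟩ := h
  exact ⟨t, e.symm.trans hX ht⟩

/-- An edge path is reduced if no equivalent edge path has a backtrack. -/
def Red : List X.Dart → Prop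
  | [] => True
  | d :: w => Red w ∧ ¬ Starts (rev d) w

/-- If exchanging the first two edges across a square created a backtrack, the same square would
carry it to a backtrack in the original path. -/
theorem Red.congr (hX : X.IsNPC) : ∀ {w w' : List X.Dart}, Red w → Eqv w w' → Red w' := by
  intro w w' hw h
  induction hn : w.length using Nat.strong_induction_on generalizing w w' with
  | _ n ih =>
  cases h with
  | nil => trivial
  | cons a h =>
    exact ⟨ih _ (by simp at hn; omega) hw.1 h rfl, fun hs => hw.2 (hs.congr hX h.symm)⟩
  | @sq a b c d w w' u s h1 h2 =>
    have l1 := h1.length_eq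
    have l2 := h2.length_eq
    simp at hn l1 l2
    have hbu : Red (b :: u) := ih _ (by omega) hw.1 h1 rfl
    have hdu : Red (d :: u) := by
      refine ⟨hbu.1, ?_⟩
      rintro ⟨u', hu'⟩
      exact hw.2 ⟨c :: u', h1.trans hX ((Eqv.cons b hu').trans hX (Eqv.swap_head s.rotate.swap u'))⟩
    refine ⟨ih _ (by simp; omega) hdu h2.symm rfl, ?_⟩
    rintro ⟨w'', hw''⟩
    obtain ⟨j, l, z, s', h3, -⟩ := (h2.symm.trans hX hw'').inv rfl rfl (s.swap.rev_ne hX)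
    obtain ⟨rfl, -⟩ := s.flipSide.unique hX s'
    exact hbu.2 ⟨z, h3⟩

theorem Red.of_append_right {w t : List X.Dart} (h : Red (w ++ t)) : Red t := by
  induction w with
  | nil => exact h
  | cons a w ih => exact ih h.1

/-- The recursive definition reads a path from its beginning; this characterization is symmetric
under reversal. -/
theorem red_iff (hX : X.IsNPC) (w : List X.Dart) :
    Red w ↔ ∀ l d r, ¬ Eqv w (l ++ d :: rev d :: r) := by
  constructor
  · intro h l d r e
    exact ((h.congr hX e).of_append_right (w := l)).2 ⟨r, Eqv.refl _⟩
  · intro h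
    induction w with
    | nil => trivial
    | cons a w ih =>
      refine ⟨ih fun l d r e => h (a :: l) d r (e.cons a), ?_⟩
      rintro ⟨w', hw'⟩
      exact h [] a w' (hw'.cons a)

theorem Red.revList (hX : X.IsNPC) {w : List X.Dart} (h : Red w) : Red (revList w) := by
  rw [red_iff hX] at h ⊢
  intro l d r e
  refine h (CubeComplex.revList r) d (CubeComplex.revList l) ?_
  have := e.revList hX
  rwa [revList_revList, revList_append, revList_cons, revList_cons, rev_rev, List.append_assoc,
    List.append_assoc] at this

open Classical in
/-- A reduced edge path obtained from `w` by pushing across squares and removing backtracks. -/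
noncomputable def nf : List X.Dart → List X.Dart
  | [] => []
  | d :: w => if h : Starts (rev d) (nf w) then h.choose else d :: nf w

theorem nf_cons_of_starts {d : X.Dart} {w : List X.Dart} (h : Starts (rev d) (nf w)) :
    Eqv (nf w) (rev d :: nf (d :: w)) := by
  rw [nf, dif_pos h]
  exact h.choose_spec

theorem nf_cons_of_not_starts {d : X.Dart} {w : List X.Dart} (h : ¬ Starts (rev d) (nf w)) :
    nf (d :: w) = d :: nf w := by
  rw [nf, dif_neg h]

theorem red_nf (hX : X.IsNPC) (w : List X.Dart) : Red (nf w) := by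
  induction w with
  | nil => trivial
  | cons d w ih =>
    by_cases h : Starts (rev d) (nf w)
    · exact (ih.congr hX (nf_cons_of_starts h)).1
    · rw [nf_cons_of_not_starts h]
      exact ⟨ih, h⟩

/-- `v` is the reduced form of `d :: u`. -/
def Act (d : X.Dart) (u v : List X.Dart) : Prop :=
  (Red (d :: u) ∧ Eqv v (d :: u)) ∨ Eqv u (rev d :: v)

theorem act_nf (hX : X.IsNPC) (d : X.Dart) (w : List X.Dart) : Act d (nf w) (nf (d :: w)) := by
  by_cases h : Starts (rev d) (nf w)
  · exact Or.inr (nf_cons_of_starts h)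
  · rw [nf_cons_of_not_starts h]
    exact Or.inl ⟨⟨red_nf hX w, h⟩, Eqv.refl _⟩

/-- Thus each dart acts as a well-defined function on equivalence classes of reduced paths. As in
van der Waerden's proof of normal forms for free products, it then remains to see that the
elementary homotopies act trivially. -/
theorem Act.unique (hX : X.IsNPC) {d : X.Dart} {u u' v v' : List X.Dart} (h : Act d u v)
    (e : Eqv u u') (h' : Act d u' v') : Eqv v v' := by
  rcases h with ⟨r, h⟩ | h <;> rcases h' with ⟨r', h'⟩ | h'
  · exact h.trans hX ((e.cons d).trans hX h'.symm)
  · exact absurd ⟨v', e.trans hX h'⟩ r.2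
  · exact absurd ⟨v, e.symm.trans hX h⟩ r'.2
  · exact (h.symm.trans hX (e.trans hX h')).of_cons hX

theorem Act.inv (hX : X.IsNPC) {d : X.Dart} {u v : List X.Dart} (hu : Red u) (h : Act d u v) :
    Act (rev d) v u := by
  rcases h with ⟨r, h⟩ | h
  · right
    rwa [rev_rev]
  · exact Or.inl ⟨hu.congr hX h, h⟩

/-- The four cases are whether `b`, and then `a`, lengthens the path or cancels. In each case the
square shows what `d` and `c` do on the other half of its boundary. -/
theorem Act.square (hX : X.IsNPC) {a b c d : X.Dart} (s : Sq a b c d) {u v₁ v₂ v v' : List X.Dart}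
    (hb : Act b u v₁) (ha : Act a v₁ v) (hd : Act d u v₂) (hc : Act c v₂ v') :
    Eqv v v' := by
  rcases hb with ⟨rb, hb⟩ | hb
  · rcases ha with ⟨ra, ha⟩ | ha
    · have e : Eqv (a :: v₁) (c :: d :: u) := (hb.cons a).trans hX (Eqv.swap_head s u)
      have r := ra.congr hX e
      have e2 := hd.unique hX (Eqv.refl u) (Or.inl ⟨r.1, Eqv.refl _⟩)
      have e3 := hc.unique hX e2 (Or.inl ⟨r, Eqv.refl _⟩)
      exact ha.trans hX (e.trans hX e3.symm)
    · obtain ⟨j, l, z, s', h1, h2⟩ := (hb.symm.trans hX ha).inv rfl rfl (s.rev_ne hX)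
      obtain ⟨rfl, rfl⟩ := s.rotate.swap.unique hX s'
      have e2 := hd.unique hX (Eqv.refl u) (Or.inr h1)
      have r1 : Red v := ((rb.congr hX hb.symm).congr hX ha).1
      have r : Red (c :: z) := r1.congr hX h2
      exact h2.trans hX (hc.unique hX e2 (Or.inl ⟨r, Eqv.refl _⟩)).symm
  · rcases ha with ⟨ra, ha⟩ | ha
    · have hnd : Red (d :: u) ∧ Eqv v₂ (d :: u) := by
        rcases hd with hd | hd
        · exact hd
        · exfalso
          obtain ⟨j, l, z, s', h1, h2⟩ := (hb.symm.trans hX hd).inv rfl rfl (s.reverse.ne hX)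
          obtain ⟨rfl, rfl⟩ := s.reverse.unique hX s'
          exact ra.2 ⟨z, h1⟩
      have e : Eqv v₂ (rev c :: a :: v₁) :=
        hnd.2.trans hX ((hb.cons d).trans hX (Eqv.swap_head s.flipSide v₁))
      exact ha.trans hX (hc.unique hX e (Or.inr (Eqv.refl _))).symm
    · have e : Eqv u (rev d :: rev c :: v) :=
        hb.trans hX ((ha.cons _).trans hX (Eqv.swap_head s.reverse v))
      have e2 := hd.unique hX (Eqv.refl u) (Or.inr e)
      exact (hc.unique hX e2 (Or.inr (Eqv.refl _))).symm

theorem nf_append_congr (hX : X.IsNPC) (l : List X.Dart) {w w' : List X.Dart}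
    (h : Eqv (nf w) (nf w')) : Eqv (nf (l ++ w)) (nf (l ++ w')) := by
  induction l with
  | nil => exact h
  | cons a l ih => exact (act_nf hX a _).unique hX ih (act_nf hX a _)

theorem nf_move (hX : X.IsNPC) {l l' : List X.Dart} (h : Move l l') : Eqv (nf l) (nf l') := by
  cases h with
  | backtrack l l' d =>
    rw [List.append_assoc]
    refine nf_append_congr hX l ?_
    have h1 := (act_nf hX (rev d) l').inv hX (red_nf hX l')
    rw [rev_rev] at h1
    exact (act_nf hX d _).unique hX (Eqv.refl _) h1
  | square l l' s =>
    rw [List.append_assoc, List.append_assoc]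
    refine nf_append_congr hX l ?_
    exact Act.square hX ⟨s, rfl, rfl, rfl, rfl⟩ (act_nf hX _ _) (act_nf hX _ _) (act_nf hX _ _)
      (act_nf hX _ _)

theorem nf_eqv_of_red (hX : X.IsNPC) {w : List X.Dart} (h : Red w) : Eqv (nf w) w := by
  induction w with
  | nil => exact Eqv.nil
  | cons d w ih =>
    exact (act_nf hX d w).unique hX (ih h.1) (Or.inl ⟨h, Eqv.refl _⟩)

theorem move_of_sq {a b c d : X.Dart} (s : Sq a b c d) (w : List X.Dart) :
    Move (a :: b :: w) (c :: d :: w) := by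
  obtain ⟨s, rfl, rfl, rfl, rfl⟩ := s
  exact Move.square [] w s

namespace PathClass

theorem mk_cons_congr {x y : X.Vertex} {a : X.Dart} {w w' : List X.Dart} (h : IsWalk x (a :: w) y)
    (h' : IsWalk x (a :: w') y) (e : mk w h.2 = mk w' h'.2) : mk (a :: w) h = mk (a :: w') h' := by
  have := congrArg (comp (mk [a] ⟨h.1, rfl⟩ : PathClass x (tgt a))) e
  exact this

theorem mk_eq_of_eqv {x y : X.Vertex} {w w' : List X.Dart} (e : Eqv w w')
    (h : IsWalk x w y) (h' : IsWalk x w' y) : mk w h = mk w' h' := by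
  induction e generalizing x with
  | nil => rfl
  | cons a _ ih => exact mk_cons_congr _ _ (ih _ _)
  | @sq a b c d w w' u s h1 h2 ih1 ih2 =>
    have k1 : IsWalk x (a :: b :: u) y := ⟨h.1, h1.isWalk h.2⟩
    have k2 : IsWalk x (c :: d :: u) y := ⟨h'.1, h2.isWalk h'.2⟩
    rw [mk_cons_congr h k1 (ih1 _ _), mk_cons_congr h' k2 (ih2 _ _)]
    exact sound _ _ (move_of_sq s u)

/-- Each step in forming `nf w` is a homotopy: a push across squares or the removal of a backtrack.
-/
theorem nf_spec {x y : X.Vertex} {w : List X.Dart} (h : IsWalk x w y) :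
    ∃ h' : IsWalk x (nf w) y, mk (nf w) h' = mk w h := by
  induction w generalizing x with
  | nil => exact ⟨h, rfl⟩
  | cons d w ih =>
    obtain ⟨h', e⟩ := ih h.2
    have k : IsWalk x (d :: nf w) y := ⟨h.1, h'⟩
    by_cases hs : Starts (rev d) (nf w)
    · have e1 := nf_cons_of_starts hs
      have k1 := e1.isWalk h'
      have k2 : IsWalk x (nf (d :: w)) y := by
        have := k1.2
        rwa [tgt_rev, h.1] at this
      refine ⟨k2, ?_⟩
      have k3 : IsWalk x (d :: rev d :: nf (d :: w)) y := ⟨h.1, k1⟩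
      rw [← sound k3 k2 (Move.backtrack [] _ d), mk_cons_congr h k e.symm]
      exact (mk_eq_of_eqv (e1.cons d) k k3).symm
    · rw [nf_cons_of_not_starts hs]
      exact ⟨k, mk_cons_congr _ _ e⟩

theorem nf_eqv_of_mk_eq (hX : X.IsNPC) {x y : X.Vertex} {w w' : List X.Dart} {h : IsWalk x w y}
    {h' : IsWalk x w' y} (e : mk w h = mk w' h') : Eqv (nf w) (nf w') := by
  have := Quot.eqvGen_exact e
  have aux : ∀ p q : Walk x y, Relation.EqvGen (fun p q : Walk x y => Move p.1 q.1) p q →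
      Eqv (nf p.1) (nf q.1) := by
    intro p q h
    induction h with
    | rel _ _ m => exact nf_move hX m
    | refl => exact Eqv.refl _
    | symm _ _ _ ih => exact ih.symm
    | trans _ _ _ _ _ ih ih' => exact ih.trans hX ih'
  exact aux _ _ this

/-- Homotopic reduced edge paths are equivalent. -/
theorem eqv_of_mk_eq (hX : X.IsNPC) {x y : X.Vertex} {w w' : List X.Dart} {h : IsWalk x w y}
    {h' : IsWalk x w' y} (e : mk w h = mk w' h') (r : Red w) (r' : Red w') : Eqv w w' :=
  (nf_eqv_of_red hX r).symm.trans hX ((nf_eqv_of_mk_eq hX e).trans hX (nf_eqv_of_red hX r'))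

end PathClass

end CubeComplex

namespace CubeComplex

variable {X : CubeComplex.{u}}

/-! ### Sliding an edge along an edge path -/

/-- The edge `c` at the origin of the edge path `α` can be moved along `α` through a strip of squares;
`e` is the resulting edge at the end of `α`, and `α'` is the opposite side of the strip. -/
inductive Slide : X.Dart → List X.Dart → List X.Dart → X.Dart → Prop
  | nil (c : X.Dart) : Slide c [] [] c
  | cons {a b c d e : X.Dart} {α α' : List X.Dart} : Sq a b c d → Slide b α α' e →
      Slide c (a :: α) (d :: α') e

namespace Slide

theorem opposite {c e : X.Dart} {α α' : List X.Dart} (h : Slide c α α' e) :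
    Slide (rev c) α' α (rev e) := by
  induction h with
  | nil c => exact nil _
  | cons s _ ih => exact cons s.flipSide ih

theorem append {c e g : X.Dart} {α α' β β' : List X.Dart} (h : Slide c α α' e)
    (h' : Slide e β β' g) : Slide c (α ++ β) (α' ++ β') g := by
  induction h with
  | nil c => exact h'
  | cons s _ ih => exact cons s (ih h')

theorem reverse {c e : X.Dart} {α α' : List X.Dart} (h : Slide c α α' e) :
    Slide e (revList α) (revList α') c := by
  induction h with
  | nil c => exact nil _
  | cons s _ ih =>
    rw [revList_cons, revList_cons]
    exact ih.append (cons s.rotate (nil _))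

theorem src_eq {c e : X.Dart} {α α' : List X.Dart} (h : Slide c α α' e) {y : X.Vertex}
    (w : IsWalk (src c) α y) : src e = y := by
  induction h with
  | nil c => exact w
  | cons s _ ih =>
    apply ih
    rw [s.src_right]
    exact w.2

theorem isWalk {c e : X.Dart} {α α' : List X.Dart} (h : Slide c α α' e) :
    IsWalk (tgt c) α' (tgt e) := by
  induction h with
  | nil c => rfl
  | cons s _ ih =>
    refine ⟨s.src_top, ?_⟩
    rwa [← s.tgt_eq]

/-- Both directions are proved together, since `sq` compares both tails with a common path: the
strip must be carried from one tail to it and then back to the other. -/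
theorem congr_aux (hX : X.IsNPC) {α β : List X.Dart} (h : Eqv α β) :
    (∀ {c e : X.Dart} {α' : List X.Dart}, Slide c α α' e → ∃ β', Slide c β β' e ∧ Eqv α' β') ∧
    (∀ {c e : X.Dart} {β' : List X.Dart}, Slide c β β' e → ∃ α', Slide c α α' e ∧ Eqv β' α') := by
  induction h with
  | nil => exact ⟨fun h => ⟨_, h, Eqv.refl _⟩, fun h => ⟨_, h, Eqv.refl _⟩⟩
  | cons a _ ih =>
    refine ⟨?_, ?_⟩
    all_goals
      intro c e α' h
      cases h with
      | cons s h =>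
      first
      | obtain ⟨β', h1, h2⟩ := ih.1 h
        exact ⟨_, cons s h1, h2.cons _⟩
      | obtain ⟨β', h1, h2⟩ := ih.2 h
        exact ⟨_, cons s h1, h2.cons _⟩
  | @sq a b a₂ d w w₂ u s _ _ ih1 ih2 =>
    have step : ∀ {a b a₂ d : X.Dart} {w w₂ : List X.Dart} (_ : Sq a b a₂ d)
        (_ : ∀ {c e : X.Dart} {α' : List X.Dart}, Slide c w α' e →
          ∃ β', Slide c (b :: u) β' e ∧ Eqv α' β')
        (_ : ∀ {c e : X.Dart} {β' : List X.Dart}, Slide c (d :: u) β' e →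
          ∃ α', Slide c w₂ α' e ∧ Eqv β' α')
        {c e : X.Dart} {α' : List X.Dart}, Slide c (a :: w) α' e →
          ∃ β', Slide c (a₂ :: w₂) β' e ∧ Eqv α' β' := by
      intro a b a₂ d w w₂ s ih1 ih2 c e α' h
      cases h with
      | @cons _ c₁ _ a' _ _ w' s1 h =>
      obtain ⟨β', h1, h2⟩ := ih1 h
      cases h1 with
      | @cons _ c₂ _ b' _ _ u' s2 h3 =>
      -- The square `s` and the first two squares of the strip meet at the end of `a`. The cube they
      -- span carries the strip over the other half of the boundary of `s`.
      obtain ⟨j, k, l, t1, t2, t3⟩ := exists_sq_of_isNPC hX s.rotate s1.rotate s2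
      have t3' := t3.rotate
      rw [rev_rev] at t3'
      have t4 : Sq d c₂ j (rev l) := by
        have := t2.rotate
        rwa [rev_rev] at this
      obtain ⟨w₂', h4, h5⟩ := ih2 (cons t4 h3)
      exact ⟨_, cons t1 h4, Eqv.sq t3' h2 h5.symm⟩
    exact ⟨step s ih1.1 ih2.2, step s.swap ih2.1 ih1.2⟩

theorem congr (hX : X.IsNPC) {α β : List X.Dart} (h : Eqv α β) {c e : X.Dart} {α' : List X.Dart}
    (hs : Slide c α α' e) : ∃ β', Slide c β β' e ∧ Eqv α' β' := (congr_aux hX h).1 hs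

theorem congr_opposite (hX : X.IsNPC) {α' β' : List X.Dart} (h : Eqv α' β') {c e : X.Dart}
    {α : List X.Dart} (hs : Slide c α α' e) : ∃ β, Slide c β β' e ∧ Eqv α β := by
  obtain ⟨β, h1, h2⟩ := hs.opposite.congr hX h
  have := h1.opposite
  rw [rev_rev, rev_rev] at this
  exact ⟨β, this, h2⟩

/-- When a backtrack is removed from `α`, the strip over it traverses the same square twice, so the
transported edge does not change. -/
theorem nf (hX : X.IsNPC) {c e : X.Dart} {α α' : List X.Dart} (h : Slide c α α' e) :
    ∃ β', Slide c (nf α) β' e := by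
  induction h with
  | nil c => exact ⟨_, nil c⟩
  | @cons a b c d e w w' s _ ih =>
    obtain ⟨β', h⟩ := ih
    by_cases hs : Starts (rev a) (CubeComplex.nf w)
    · obtain ⟨β₁, h1, -⟩ := h.congr hX (nf_cons_of_starts hs)
      cases h1 with
      | cons s1 h1 =>
      obtain ⟨rfl, -⟩ := s.rotate.unique hX s1
      exact ⟨_, h1⟩
    · rw [nf_cons_of_not_starts hs]
      exact ⟨_, cons s h⟩

theorem dirParallel {c e : X.Dart} {α α' : List X.Dart} (h : Slide c α α' e) :
    DirParallel c e := by
  induction h with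
  | nil c => exact Relation.EqvGen.refl _
  | cons s _ ih =>
    obtain ⟨q, h1, h2, h3, h4⟩ := s.swap
    exact Relation.EqvGen.trans _ _ _ (Relation.EqvGen.rel _ _ ⟨q, h1, h4⟩) ih

end Slide

theorem Sq.dirParallel {a b c d : X.Dart} (s : Sq a b c d) : DirParallel c b :=
  (Slide.cons s (Slide.nil _)).dirParallel

theorem exists_slide_of_dirParallel {c e : X.Dart} (h : DirParallel c e) :
    ∃ α α', Slide c α α' e ∧ IsWalk (src c) α (src e) := by
  induction h with
  | rel c e h =>
    obtain ⟨s, rfl, rfl⟩ := h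
    have : Sq (edge s ![false, false] 0) _ _ _ := ⟨s, rfl, rfl, rfl, rfl⟩
    exact ⟨_, _, Slide.cons this.swap (Slide.nil _), this.src_eq.symm, this.src_top.symm⟩
  | refl c => exact ⟨[], [], Slide.nil _, rfl⟩
  | symm _ _ _ ih =>
    obtain ⟨α, α', h, w⟩ := ih
    exact ⟨_, _, h.reverse, w.revList⟩
  | trans _ _ _ _ _ ih ih' =>
    obtain ⟨α, α', h, w⟩ := ih
    obtain ⟨β, β', h', w'⟩ := ih'
    exact ⟨_, _, h.append h', (isWalk_append _ _).2 ⟨_, w, w'⟩⟩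

/-- In a simply connected nonpositively curved complex, a hyperplane is dual to at most one edge
at each vertex on a given side. -/
theorem eq_of_dirParallel_of_isSimplyConnected (hX : X.IsNPC) (hs : X.IsSimplyConnected)
    {c e : X.Dart} (h : DirParallel c e) (hsrc : src c = src e) : c = e := by
  obtain ⟨α, α', h, w⟩ := exists_slide_of_dirParallel h
  rw [← hsrc] at w
  have e1 : PathClass.mk α w = PathClass.mk [] rfl := (hs.2 _).elim _ _
  -- The strip runs over a closed path, whose normal form is empty; a strip over the empty path does
  -- not move its edge.
  have e2 := (PathClass.nf_eqv_of_mk_eq hX e1).length_eq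
  obtain ⟨β', h2⟩ := h.nf hX
  rw [List.eq_nil_of_length_eq_zero e2] at h2
  cases h2
  rfl

/-! ### Locally convex sets of edges -/

/-- A set of edges that with two sides of a square at a vertex contains all sides of the square. -/
structure IsConvexSet (D : Set X.Dart) : Prop where
  rev_mem : ∀ {d : X.Dart}, d ∈ D → rev d ∈ D
  sq_mem : ∀ {a b c d : X.Dart}, a ∈ D → c ∈ D → Sq a b c d → b ∈ D

namespace IsConvexSet

variable {D : Set X.Dart}

theorem inter (hD : IsConvexSet D) {E : Set X.Dart} (hE : IsConvexSet E) :
    IsConvexSet (D ∩ E) :=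
  ⟨fun h => ⟨hD.rev_mem h.1, hE.rev_mem h.2⟩,
    fun ha hc s => ⟨hD.sq_mem ha.1 hc.1 s, hE.sq_mem ha.2 hc.2 s⟩⟩

theorem eqv_mem (hD : IsConvexSet D) {w w' : List X.Dart} (h : Eqv w w') (hw : ∀ d ∈ w, d ∈ D) :
    ∀ d ∈ w', d ∈ D := by
  suffices (∀ d ∈ w, d ∈ D) ↔ (∀ d ∈ w', d ∈ D) from this.1 hw
  clear hw
  have step : ∀ {a b c d : X.Dart}, Sq a b c d → a ∈ D ∧ b ∈ D → c ∈ D ∧ d ∈ D := by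
    intro a b c d s h
    have hc := hD.sq_mem (hD.rev_mem h.1) h.2 s.rotate
    exact ⟨hc, hD.sq_mem hc h.1 s.swap⟩
  induction h with
  | nil => exact Iff.rfl
  | cons a _ ih =>
    simp only [List.forall_mem_cons, ih]
  | sq s _ _ ih1 ih2 =>
    simp only [List.forall_mem_cons] at ih1 ih2 ⊢
    refine (and_congr_right fun _ => ih1).trans (Iff.trans ?_ (and_congr_right fun _ => ih2).symm)
    exact ⟨fun h => ⟨(step s ⟨h.1, h.2.1⟩).1, (step s ⟨h.1, h.2.1⟩).2, h.2.2⟩,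
      fun h => ⟨(step s.swap ⟨h.1, h.2.1⟩).1, (step s.swap ⟨h.1, h.2.1⟩).2, h.2.2⟩⟩

theorem mem_revList (hD : IsConvexSet D) {l : List X.Dart}
    (h : ∀ d ∈ l, d ∈ D) : ∀ d ∈ revList l, d ∈ D := by
  intro d hd
  simp only [revList, List.mem_reverse, List.mem_map] at hd
  obtain ⟨e, he, rfl⟩ := hd
  exact hD.rev_mem (h e he)

theorem slide_mem (hD : IsConvexSet D) {c e : X.Dart} {α α' : List X.Dart} (h : Slide c α α' e)
    (hc : c ∈ D) (hα : ∀ d ∈ α, d ∈ D) : e ∈ D := by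
  induction h with
  | nil => exact hc
  | cons s _ ih =>
    rw [List.forall_mem_cons] at hα
    exact ih (hD.sq_mem hα.1 hc s) hα.2

theorem nf_mem (hD : IsConvexSet D) {w : List X.Dart} (hw : ∀ d ∈ w, d ∈ D) :
    ∀ d ∈ nf w, d ∈ D := by
  induction w with
  | nil => exact hw
  | cons a w ih =>
    rw [List.forall_mem_cons] at hw
    by_cases h : Starts (rev a) (nf w)
    · have := hD.eqv_mem (nf_cons_of_starts h) (ih hw.2)
      rw [List.forall_mem_cons] at this
      exact this.2
    · rw [nf_cons_of_not_starts h, List.forall_mem_cons]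
      exact ⟨hw.1, ih hw.2⟩

end IsConvexSet

/-- To bring an edge of `t` to the front, it must be pushed past all of `α`, and the squares used
for this form a strip along `α`. -/
theorem exists_slide_of_eqv (hX : X.IsNPC) {α t w : List X.Dart} {c : X.Dart}
    (h : Eqv (α ++ t) (c :: w)) :
    Starts c α ∨ ∃ α' e t', Slide c α α' e ∧ Eqv t (e :: t') ∧ Eqv w (α' ++ t') := by
  induction α generalizing c w with
  | nil => exact Or.inr ⟨[], c, w, Slide.nil _, h, Eqv.refl _⟩
  | cons a α ih =>
    cases h with
    | cons _ h => exact Or.inl ⟨α, Eqv.refl _⟩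
    | @sq _ b _ d _ _ u s h1 h2 =>
      rcases ih h1 with ⟨α₁, h3⟩ | ⟨α', e, t', h3, h4, h5⟩
      · exact Or.inl ⟨d :: α₁, (h3.cons a).trans hX (Eqv.swap_head s _)⟩
      · exact Or.inr ⟨d :: α', e, t', Slide.cons s h3, h4, h2.trans hX (h5.cons d)⟩

/-- The concatenation of a reduced path in a convex set and a reduced path that leaves it is
reduced. -/
theorem IsConvexSet.red_append (hX : X.IsNPC) {D : Set X.Dart} (hD : IsConvexSet D)
    {α γ : List X.Dart} (hα : Red α) (hαD : ∀ d ∈ α, d ∈ D) (hγ : Red γ)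
    (hγD : ∀ d ∈ D, ¬ Starts d γ) : Red (α ++ γ) := by
  induction α with
  | nil => exact hγ
  | cons a α ih =>
    rw [List.forall_mem_cons] at hαD
    refine ⟨ih hα.1 hαD.2, ?_⟩
    rintro ⟨w, hw⟩
    rcases exists_slide_of_eqv hX hw with h | ⟨α', e, t', h1, h2, -⟩
    · exact hα.2 h
    · exact hγD e (hD.slide_mem h1 (hD.rev_mem hαD.1) hαD.2) ⟨t', h2⟩

/-- The edges of the path `γ` can be moved one after the other along `α`; the last opposite side is
`α'`. -/
def SlideAll : List X.Dart → List X.Dart → List X.Dart → Prop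
  | [], α, α' => α = α'
  | c :: γ, α, α' => ∃ α₁ e, Slide c α α₁ e ∧ SlideAll γ α₁ α'

/-- The edges of `γ` are peeled off one at a time. By `hcop` each slides along the current side of
the region, using up one edge of `γ₂`. The equal lengths ensure that `γ₂` is exhausted together with
`γ`. -/
theorem exists_slideAll_of_eqv (hX : X.IsNPC) {α γ γ₂ β : List X.Dart}
    (hcop : ∀ e, Starts e α → ¬ Starts e γ) (hlen : γ₂.length = γ.length)
    (h : Eqv (α ++ γ₂) (γ ++ β)) : ∃ α', SlideAll γ α α' ∧ Eqv α' β := by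
  induction γ generalizing α γ₂ with
  | nil =>
    rw [List.eq_nil_of_length_eq_zero hlen, List.append_nil] at h
    exact ⟨α, rfl, h⟩
  | cons c γ ih =>
    rcases exists_slide_of_eqv hX h with hs | ⟨α₁, e, t, h1, h2, h3⟩
    · exact absurd ⟨γ, Eqv.refl _⟩ (hcop c hs)
    · have l2 := h2.length_eq
      simp at l2 hlen
      obtain ⟨α', h4, h5⟩ := ih (α := α₁) (γ₂ := t) (by
        rintro g ⟨α₂, hα₂⟩ ⟨γ', hγ'⟩
        -- An edge that starts both the new side and the rest of `γ` can be carried back across the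
        -- first square of the strip, where it contradicts `hcop`.
        obtain ⟨β, h6, h7⟩ := h1.congr_opposite hX hα₂
        cases h6 with
        | cons s h6 =>
        exact hcop _ ⟨_, h7⟩ ⟨_, (hγ'.cons c).trans hX (Eqv.swap_head s.swap _)⟩) (by omega) h3.symm
      exact ⟨α', ⟨α₁, e, h1, h4⟩, h5⟩

/-- Both halves of the quadrilateral are reduced, since the connecting paths leave the convex sets
at once; being homotopic, they are therefore equivalent. The product region is read off from this
equivalence. -/
theorem IsConvexSet.exists_slideAll (hX : X.IsNPC) {D E : Set X.Dart} (hD : IsConvexSet D)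
    (hE : IsConvexSet E) {α β γ γ₂ : List X.Dart} {x y : X.Vertex}
    (hα : Red α) (hαD : ∀ d ∈ α, d ∈ D) (hβ : Red β) (hβE : ∀ d ∈ β, d ∈ E)
    (hγ : Red γ) (hγD : ∀ d ∈ D, ¬ Starts d γ) (hγE : ∀ d ∈ E, ¬ Starts d (revList γ))
    (hγ₂ : Red γ₂) (hγ₂D : ∀ d ∈ D, ¬ Starts d γ₂) (hlen : γ₂.length = γ.length)
    (h1 : IsWalk x (α ++ γ₂) y) (h2 : IsWalk x (γ ++ β) y)
    (h : PathClass.mk _ h1 = PathClass.mk _ h2) :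
    ∃ α', SlideAll γ α α' ∧ ∀ d ∈ α', d ∈ E := by
  have r1 : Red (α ++ γ₂) := hD.red_append hX hα hαD hγ₂ hγ₂D
  have r2 : Red (γ ++ β) := by
    have := hE.red_append hX (hβ.revList hX) (hE.mem_revList hβE) (hγ.revList hX) hγE
    have := this.revList hX
    rwa [revList_append, revList_revList, revList_revList] at this
  obtain ⟨α', h3, h4⟩ := exists_slideAll_of_eqv hX (by
    rintro e ⟨α₁, h3⟩ h4
    exact hγD e (hD.eqv_mem h3 hαD e (by simp)) h4) hlen (PathClass.eqv_of_mk_eq hX h r1 r2)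
  exact ⟨α', h3, hE.eqv_mem h4.symm hβE⟩

/-! ### Pushing a convex set across hyperplanes -/

/-- Hyperplanes do not cross or osculate themselves on one side. -/
def HasNoSelfOsculation (X : CubeComplex.{u}) : Prop :=
  ∀ c e : X.Dart, DirParallel c e → src c = src e → c = e

/-- The edges whose translate across the hyperplane dual to `c` belongs to `B`. -/
def pull (c : X.Dart) (B : Set X.Dart) : Set X.Dart :=
  {a | ∃ e b d, DirParallel c e ∧ Sq a b e d ∧ d ∈ B}

/-- The edges whose translate across the hyperplanes dual to the edges of `γ` belongs to `B`. -/
def pullAll : List X.Dart → Set X.Dart → Set X.Dart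
  | [], B => B
  | c :: γ, B => pull c (pullAll γ B)

/-- Two edges at a vertex that can be pushed across the hyperplane are pushed along the same dual
edge, by `hos`. If they span a square, that edge completes it to a cube, whose opposite face has two
sides in `B`. -/
theorem IsConvexSet.pull (hX : X.IsNPC) (hos : X.HasNoSelfOsculation) {B : Set X.Dart}
    (hB : IsConvexSet B) (c : X.Dart) : IsConvexSet (pull c B) := by
  constructor
  · rintro a ⟨e, b, d, h1, h2, h3⟩
    exact ⟨b, e, rev d, Relation.EqvGen.trans _ _ _ h1 h2.dirParallel, h2.rotate, hB.rev_mem h3⟩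
  · rintro a₁ b₁ a₂ b₂ ⟨e, b, d, h1, h2, h3⟩ ⟨e', b', d', h1', h2', h3'⟩ s
    obtain rfl : e = e' := hos _ _
      (Relation.EqvGen.trans _ _ _ (Relation.EqvGen.symm _ _ h1) h1')
      (by rw [← h2.src_eq, ← h2'.src_eq, s.src_eq])
    obtain ⟨j, k, l, t1, t2, t3⟩ := exists_sq_of_isNPC hX s h2 h2'
    exact ⟨b, j, k, Relation.EqvGen.trans _ _ _ h1 h2.dirParallel, t1, hB.sq_mem h3 h3' t3⟩

theorem IsConvexSet.pullAll (hX : X.IsNPC) (hos : X.HasNoSelfOsculation) {B : Set X.Dart}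
    (hB : IsConvexSet B) (γ : List X.Dart) : IsConvexSet (pullAll γ B) := by
  induction γ with
  | nil => exact hB
  | cons c γ ih => exact ih.pull hX hos c

theorem Slide.mem_pull {c e : X.Dart} {α α' : List X.Dart} (h : Slide c α α' e) {B : Set X.Dart}
    (hB : ∀ d ∈ α', d ∈ B) : ∀ d ∈ α, d ∈ pull c B := by
  -- Further along the strip the dual edge is only parallel to the initial one, so the induction
  -- must allow any representative of the hyperplane.
  suffices ∀ c₀, DirParallel c₀ c → ∀ d ∈ α, d ∈ pull c₀ B from this c (Relation.EqvGen.refl _)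
  induction h with
  | nil => simp
  | @cons a b c d e w w' s _ ih =>
    intro c₀ h0
    rw [List.forall_mem_cons] at hB ⊢
    exact ⟨⟨c, b, d, h0, s, hB.1⟩, ih hB.2 c₀ (Relation.EqvGen.trans _ _ _ h0 s.dirParallel)⟩

theorem SlideAll.mem_pullAll {γ α α' : List X.Dart} (h : SlideAll γ α α') {B : Set X.Dart}
    (hB : ∀ d ∈ α', d ∈ B) : ∀ d ∈ α, d ∈ CubeComplex.pullAll γ B := by
  induction γ generalizing α with
  | nil =>
    obtain rfl : α = α' := h
    exact hB
  | cons c γ ih =>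
    obtain ⟨α₁, e, h1, h2⟩ := h
    exact h1.mem_pull (ih h2)

end CubeComplex

/-! ### Images of squares and strips under combinatorial maps -/

namespace CubeMap

variable {X Y : CubeComplex.{u}}

theorem sq (φ : CubeMap Y X) {a b c d : Y.Dart} (s : Sq a b c d) :
    Sq (φ.toFun a) (φ.toFun b) (φ.toFun c) (φ.toFun d) := by
  obtain ⟨s, rfl, rfl, rfl, rfl⟩ := s
  exact ⟨φ.toFun s, (φ.naturality _ _).symm, (φ.naturality _ _).symm, (φ.naturality _ _).symm,
    (φ.naturality _ _).symm⟩

theorem slide (φ : CubeMap Y X) {c e : Y.Dart} {α α' : List Y.Dart} (h : Slide c α α' e) :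
    Slide (φ.toFun c) (α.map φ.toFun) (α'.map φ.toFun) (φ.toFun e) := by
  induction h with
  | nil c => exact Slide.nil _
  | cons s _ ih => exact Slide.cons (φ.sq s) ih

theorem slideAll (φ : CubeMap Y X) {γ α α' : List Y.Dart} (h : SlideAll γ α α') :
    SlideAll (γ.map φ.toFun) (α.map φ.toFun) (α'.map φ.toFun) := by
  induction γ generalizing α with
  | nil => exact congrArg _ (show α = α' from h)
  | cons c γ ih =>
    obtain ⟨α₁, e, h1, h2⟩ := h
    exact ⟨_, _, φ.slide h1, ih h2⟩

theorem src_toFun (φ : CubeMap Y X) (d : Y.Dart) : φ.toFun (src d) = src (φ.toFun d) :=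
  φ.naturality _ _

theorem tgt_toFun (φ : CubeMap Y X) (d : Y.Dart) : φ.toFun (tgt d) = tgt (φ.toFun d) :=
  φ.naturality _ _

theorem rev_toFun (φ : CubeMap Y X) (d : Y.Dart) : φ.toFun (rev d) = rev (φ.toFun d) :=
  φ.naturality _ _

theorem isConvexSet_preimage (φ : CubeMap Y X) {D : Set X.Dart} (hD : IsConvexSet D) :
    IsConvexSet {d : Y.Dart | φ.toFun d ∈ D} :=
  ⟨fun h => by
    rw [Set.mem_ofPred_eq, φ.rev_toFun]
    exact hD.rev_mem h, fun ha hc s => hD.sq_mem ha hc (φ.sq s)⟩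

end CubeMap

namespace CubeComplex

/-- The 1-skeleton of the cube is connected. -/
theorem hypercube_induction {n : ℕ} {P : (Fin n → Bool) → Prop} (h0 : P fun _ => false)
    (h : ∀ x i, P x → P (Function.update x i (!x i))) (x : Fin n → Bool) : P x := by
  have key : ∀ s : Finset (Fin n), P fun i => decide (i ∈ s) := by
    intro s
    induction s using Finset.induction_on with
    | empty => simpa using h0
    | insert a s ha ih =>
      convert h _ a ih using 1
      funext j
      by_cases hj : j = a
      · subst hj; simp [ha]
      · simp [hj]
  have := key (Finset.univ.filter fun i => x i = true)
  simpa using this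

theorem corner_vertex {X : CubeComplex.{u}} (v : X.Vertex) (x : Fin 0 → Bool) :
    corner v x = v := by
  unfold corner
  conv_rhs => rw [← X.map_id v]
  congr 1
  ext t i
  exact i.elim0

theorem origin_vertex {X : CubeComplex.{u}} (v : X.Vertex) : origin v = v := corner_vertex v _

end CubeComplex

/-! ### Covering maps: lifting squares, parallelism and edge paths -/

namespace CubeMap

variable {X Y Z : CubeComplex.{u}}

/-- The image of a homotopy class of edge paths. -/
def pathMap (φ : CubeMap Y X) {v w : Y.Vertex} :
    PathClass v w → PathClass (φ.toFun v) (φ.toFun w) :=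
  Quot.map (fun P => ⟨P.1.map φ.toFun, φ.isWalk P.2⟩) fun _ _ h => φ.move h

theorem origin_toFun (φ : CubeMap Y X) {n : ℕ} (c : Y.cube n) :
    φ.toFun (origin c) = origin (φ.toFun c) := φ.naturality _ _

theorem edge_toFun (φ : CubeMap Y X) {n : ℕ} (c : Y.cube n) (x : Fin n → Bool) (i : Fin n) :
    φ.toFun (edge c x i) = edge (φ.toFun c) x i := φ.naturality _ _

theorem axis_toFun (φ : CubeMap Y X) {n : ℕ} (c : Y.cube n) (i : Fin n) :
    φ.toFun (axis c i) = axis (φ.toFun c) i := φ.naturality _ _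

theorem congr_toFun {φ ψ : CubeMap Y X} (h : φ = ψ) {n : ℕ} (c : Y.cube n) :
    φ.toFun c = ψ.toFun c := by rw [h]

namespace IsCovering

variable {p : CubeMap Y X}

theorem eq_of_eq (hp : p.IsCovering) {n : ℕ} {c c' : Y.cube n} (h : origin c = origin c')
    (h' : p.toFun c = p.toFun c') : c = c' :=
  (hp (origin c) (p.toFun c) (p.origin_toFun c).symm).unique ⟨rfl, rfl⟩ ⟨h.symm, h'.symm⟩

theorem exists_lift (hp : p.IsCovering) (y : Y.Vertex) {n : ℕ} (c : X.cube n)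
    (h : origin c = p.toFun y) : ∃ c' : Y.cube n, origin c' = y ∧ p.toFun c' = c :=
  (hp y c h).exists

theorem exists_dart (hp : p.IsCovering) (y : Y.Vertex) (d : X.Dart) (h : src d = p.toFun y) :
    ∃ d' : Y.Dart, src d' = y ∧ p.toFun d' = d := hp.exists_lift y d h

theorem dart_eq (hp : p.IsCovering) {d d' : Y.Dart} (h : src d = src d')
    (h' : p.toFun d = p.toFun d') : d = d' := hp.eq_of_eq h h'

theorem exists_sq (hp : p.IsCovering) {a b c d : X.Dart} (s : Sq a b c d) {a' : Y.Dart}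
    (h : p.toFun a' = a) : ∃ b' c' d' : Y.Dart, Sq a' b' c' d' ∧ p.toFun b' = b ∧ p.toFun c' = c ∧
      p.toFun d' = d := by
  subst h
  obtain ⟨s, h1, rfl, rfl, rfl⟩ := s
  obtain ⟨s', hs', rfl⟩ := hp.exists_lift (src a') s (by
    rw [p.src_toFun, ← h1, src_edge, zero_two]
    rfl)
  refine ⟨_, _, _, ⟨s', ?_, rfl, rfl, rfl⟩, p.edge_toFun _ _ _, p.edge_toFun _ _ _,
    p.edge_toFun _ _ _⟩
  apply hp.dart_eq
  · rw [src_edge, ← hs', zero_two]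
    rfl
  · rw [p.edge_toFun, h1]

theorem exists_sq_of_src_eq (hp : p.IsCovering) {a c : Y.Dart} {b d : X.Dart}
    (s : Sq (p.toFun a) b (p.toFun c) d) (h : src a = src c) :
    ∃ b' d' : Y.Dart, Sq a b' c d' ∧ p.toFun b' = b ∧ p.toFun d' = d := by
  obtain ⟨b', c', d', s', h1, h2, h3⟩ := hp.exists_sq s rfl
  obtain rfl : c' = c := hp.dart_eq (s'.src_eq.symm.trans h) h2
  exact ⟨b', d', s', h1, h3⟩

theorem exists_dirParallel (hp : p.IsCovering) {c e : X.Dart} (h : DirParallel c e) :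
    ∀ c' : Y.Dart, p.toFun c' = c → ∃ e', p.toFun e' = e ∧ DirParallel c' e' := by
  suffices (∀ c' : Y.Dart, p.toFun c' = c → ∃ e', p.toFun e' = e ∧ DirParallel c' e') ∧
      (∀ e' : Y.Dart, p.toFun e' = e → ∃ c', p.toFun c' = c ∧ DirParallel e' c') from this.1
  induction h with
  | rel c e h =>
    obtain ⟨s, h1, h2⟩ := h
    have s' : Sq c _ _ e := ⟨s, h1, rfl, rfl, h2⟩
    refine ⟨fun a ha => ?_, fun a ha => ?_⟩
    · obtain ⟨b', c', d', t, -, -, h4⟩ := hp.exists_sq s' ha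
      exact ⟨d', h4, t.swap.dirParallel⟩
    · obtain ⟨b', c', d', t, -, -, h4⟩ := hp.exists_sq s'.flipSide ha
      exact ⟨d', h4, t.swap.dirParallel⟩
  | refl c => exact ⟨fun a ha => ⟨a, ha, Relation.EqvGen.refl _⟩,
      fun a ha => ⟨a, ha, Relation.EqvGen.refl _⟩⟩
  | symm _ _ _ ih => exact ⟨ih.2, ih.1⟩
  | trans _ _ _ _ _ ih ih' =>
    refine ⟨fun a ha => ?_, fun a ha => ?_⟩
    · obtain ⟨b, hb, h1⟩ := ih.1 a ha
      obtain ⟨c, hc, h2⟩ := ih'.1 b hb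
      exact ⟨c, hc, Relation.EqvGen.trans _ _ _ h1 h2⟩
    · obtain ⟨b, hb, h1⟩ := ih'.2 a ha
      obtain ⟨c, hc, h2⟩ := ih.2 b hb
      exact ⟨c, hc, Relation.EqvGen.trans _ _ _ h1 h2⟩

/-- A covering identifies links, and nonpositive curvature is a condition on links. -/
theorem isNPC (hp : p.IsCovering) (hX : X.IsNPC) : Y.IsNPC where
  axis_injective c i j h := by
    apply hX.axis_injective (p.toFun c)
    rw [← p.axis_toFun, ← p.axis_toFun, h]
  eq_of_axis_eq c c' h h' := by
    refine hp.eq_of_eq h (hX.eq_of_axis_eq _ _ ?_ ?_)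
    · rw [← p.origin_toFun, ← p.origin_toFun, h]
    · funext i
      rw [← p.axis_toFun, ← p.axis_toFun, h']
  flag v n d hd h := by
    obtain ⟨c, hc, hax⟩ := hX.flag (p.toFun v) (fun i => p.toFun (d i))
      (fun i => by rw [← p.src_toFun, hd]) (fun i j hij => by
        obtain ⟨s, h1, h2⟩ := h i j hij
        exact ⟨p.toFun s, by rw [← p.axis_toFun, h1], by rw [← p.axis_toFun, h2]⟩)
    obtain ⟨c', h1, rfl⟩ := hp.exists_lift v c hc
    refine ⟨c', h1, funext fun i => hp.dart_eq ?_ ?_⟩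
    · rw [src_axis, h1, hd]
    · rw [p.axis_toFun, hax]

theorem exists_walk (hp : p.IsCovering) {l : List X.Dart} {w : X.Vertex} {y : Y.Vertex}
    (h : IsWalk (p.toFun y) l w) :
    ∃ l' y', IsWalk y l' y' ∧ l'.map p.toFun = l ∧ p.toFun y' = w := by
  induction l generalizing y with
  | nil => exact ⟨[], y, rfl, rfl, h⟩
  | cons d l ih =>
    obtain ⟨d', h1, rfl⟩ := hp.exists_dart y d h.1
    have h2 := h.2
    rw [← p.tgt_toFun] at h2
    obtain ⟨l', y', h3, rfl, h4⟩ := ih h2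
    exact ⟨d' :: l', y', ⟨h1, h3⟩, rfl, h4⟩

theorem walk_unique (hp : p.IsCovering) {l l' : List Y.Dart} {y z z' : Y.Vertex}
    (h : IsWalk y l z) (h' : IsWalk y l' z') (e : l.map p.toFun = l'.map p.toFun) :
    l = l' ∧ z = z' := by
  induction l generalizing y l' with
  | nil =>
    cases l' with
    | nil => exact ⟨rfl, (show y = z from h).symm.trans h'⟩
    | cons => simp at e
  | cons d l ih =>
    cases l' with
    | nil => simp at e
    | cons d' l' =>
      simp only [List.map_cons, List.cons.injEq] at e
      obtain rfl : d = d' := hp.dart_eq (h.1.trans h'.1.symm) e.1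
      obtain ⟨rfl, h3⟩ := ih h.2 h'.2 e.2
      exact ⟨rfl, h3⟩

end IsCovering

end CubeMap

namespace CubeComplex

variable {X : CubeComplex.{u}}

theorem IsWalk.end_unique {x y z : X.Vertex} {l : List X.Dart} (h : IsWalk x l y)
    (h' : IsWalk x l z) : y = z := by
  induction l generalizing x with
  | nil => exact (show x = y from h).symm.trans h'
  | cons d l ih => exact ih h.2 h'.2

theorem IsSimplyConnected.mk_eq (hX : X.IsSimplyConnected) {v w : X.Vertex} (g g' : PathClass v w) :
    g = g' := by
  have := (hX.2 v).elim (g.comp g'.symm) (PathClass.refl v)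
  calc g = (g.comp g'.symm).comp g' := by
        rw [PathClass.comp_assoc, PathClass.symm_comp, PathClass.comp_refl]
    _ = g' := by rw [this, PathClass.refl_comp]

theorem PathClass.mk_append {x y z : X.Vertex} {l l' : List X.Dart} (h : IsWalk x l y)
    (h' : IsWalk y l' z) :
    mk (l ++ l') ((isWalk_append l l').2 ⟨y, h, h'⟩) = (mk l h).comp (mk l' h') := rfl

end CubeComplex

/-! ### Covering maps: lifting homotopies and maps -/

namespace CubeMap

variable {X Y Z : CubeComplex.{u}}

namespace IsCovering

variable {p : CubeMap Y X}

theorem lift_move (hp : p.IsCovering) {y z : Y.Vertex} {w : X.Vertex} {m m' : List X.Dart}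
    (hm : IsWalk (p.toFun y) m w) (hm' : IsWalk (p.toFun y) m' w) (mv : Move m m' ∨ Move m' m)
    {l : List Y.Dart} (h : IsWalk y l z) (e : l.map p.toFun = m) :
    ∃ (l' : List Y.Dart) (h' : IsWalk y l' z), l'.map p.toFun = m' ∧
      PathClass.mk l h = PathClass.mk l' h' := by
  have square : ∀ (k r : List X.Dart) {a b c d : X.Dart}, Sq a b c d →
      l.map p.toFun = k ++ [a, b] ++ r → ∃ (l' : List Y.Dart) (h' : IsWalk y l' z),
      l'.map p.toFun = k ++ [c, d] ++ r ∧ PathClass.mk l h = PathClass.mk l' h' := by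
    intro k r a b c d s e
    rw [List.append_assoc, List.map_eq_append_iff] at e
    obtain ⟨l₁, l₂, rfl, rfl, e⟩ := e
    rw [List.map_eq_append_iff] at e
    obtain ⟨l₃, l₄, rfl, e, rfl⟩ := e
    simp only [List.map_eq_cons_iff] at e
    obtain ⟨a', t, rfl, rfl, b', t', rfl, rfl, e⟩ := e
    obtain rfl : t' = [] := by simpa using e
    obtain ⟨b'', c', d', s', h1, h2, h3⟩ := hp.exists_sq s rfl
    have h0 := h
    rw [isWalk_append] at h0
    obtain ⟨x₁, k1, k2, k3, k4⟩ := h0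
    obtain rfl : b'' = b' := hp.dart_eq (s'.src_right.trans k3.symm) h1
    have ev : Eqv (l₁ ++ ([a', b''] ++ l₄)) (l₁ ++ ([c', d'] ++ l₄)) :=
      Eqv.append_left _ (Eqv.swap_head s' l₄)
    exact ⟨_, ev.isWalk h, by simp [h2, h3], PathClass.mk_eq_of_eqv ev _ _⟩
  rcases mv with mv | mv
  · cases mv with
    | backtrack k r d =>
      rw [List.append_assoc, List.map_eq_append_iff] at e
      obtain ⟨l₁, l₂, rfl, rfl, e⟩ := e
      rw [List.map_eq_append_iff] at e
      obtain ⟨l₃, l₄, rfl, e, rfl⟩ := e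
      simp only [List.map_eq_cons_iff] at e
      obtain ⟨a', t, rfl, rfl, b', t', rfl, hb, e⟩ := e
      obtain rfl : t' = [] := by simpa using e
      have h0 := h
      rw [isWalk_append] at h0
      obtain ⟨x₁, k1, k2, k3, k4⟩ := h0
      obtain rfl : b' = rev a' := hp.dart_eq (k3.trans (src_rev _).symm) (by rw [hb, p.rev_toFun])
      have h' : IsWalk y (l₁ ++ l₄) z := by
        rw [isWalk_append]
        refine ⟨x₁, k1, ?_⟩
        rwa [tgt_rev, k2] at k4
      refine ⟨_, h', by simp, PathClass.sound _ _ ?_⟩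
      have := Move.backtrack l₁ l₄ a'
      rwa [List.append_assoc] at this
    | square k r s => exact square k r ⟨s, rfl, rfl, rfl, rfl⟩ e
  · cases mv with
    | backtrack k r d =>
      rw [List.map_eq_append_iff] at e
      obtain ⟨l₁, l₂, rfl, rfl, rfl⟩ := e
      have h0 := h
      rw [isWalk_append] at h0
      obtain ⟨x₁, k1, k2⟩ := h0
      rw [List.append_assoc, isWalk_append] at hm'
      obtain ⟨x₂, k3, k4, k5⟩ := hm'
      obtain rfl := k3.end_unique (p.isWalk k1)
      obtain ⟨d', h1, rfl⟩ := hp.exists_dart x₁ d k4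
      have h' : IsWalk y (l₁ ++ [d', rev d'] ++ l₂) z := by
        rw [List.append_assoc, isWalk_append]
        exact ⟨x₁, k1, h1, src_rev _, by rw [tgt_rev, h1]; exact k2⟩
      exact ⟨_, h', by simp [p.rev_toFun], (PathClass.sound _ _ (Move.backtrack l₁ l₂ d')).symm⟩
    | square k r s => exact square k r (Sq.swap ⟨s, rfl, rfl, rfl, rfl⟩) e

theorem lift_homotopy (hp : p.IsCovering) {y z : Y.Vertex} {w : X.Vertex} {m m' : List X.Dart}
    {x : X.Vertex} (hx : p.toFun y = x)
    {hm : IsWalk x m w} {hm' : IsWalk x m' w}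
    (hmm : PathClass.mk m hm = PathClass.mk m' hm')
    {l : List Y.Dart} (h : IsWalk y l z) (e : l.map p.toFun = m) :
    ∃ (l' : List Y.Dart) (h' : IsWalk y l' z), l'.map p.toFun = m' ∧
      PathClass.mk l h = PathClass.mk l' h' := by
  subst hx
  have aux : ∀ P Q : Walk (p.toFun y) w,
      Relation.EqvGen (fun P Q : Walk (p.toFun y) w => Move P.1 Q.1) P Q →
      (∀ {l : List Y.Dart} (h : IsWalk y l z), l.map p.toFun = P.1 →
        ∃ (l' : List Y.Dart) (h' : IsWalk y l' z), l'.map p.toFun = Q.1 ∧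
          PathClass.mk l h = PathClass.mk l' h') ∧
      (∀ {l : List Y.Dart} (h : IsWalk y l z), l.map p.toFun = Q.1 →
        ∃ (l' : List Y.Dart) (h' : IsWalk y l' z), l'.map p.toFun = P.1 ∧
          PathClass.mk l h = PathClass.mk l' h') := by
    intro P Q h
    induction h with
    | rel P Q m => exact ⟨fun h e => hp.lift_move P.2 Q.2 (Or.inl m) h e,
        fun h e => hp.lift_move Q.2 P.2 (Or.inr m) h e⟩
    | refl P => exact ⟨fun h e => ⟨_, h, e, rfl⟩, fun h e => ⟨_, h, e, rfl⟩⟩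
    | symm _ _ _ ih => exact ⟨ih.2, ih.1⟩
    | trans _ _ _ _ _ ih ih' =>
      refine ⟨fun h e => ?_, fun h e => ?_⟩
      · obtain ⟨l₁, h₁, e₁, k₁⟩ := ih.1 h e
        obtain ⟨l₂, h₂, e₂, k₂⟩ := ih'.1 h₁ e₁
        exact ⟨l₂, h₂, e₂, k₁.trans k₂⟩
      · obtain ⟨l₁, h₁, e₁, k₁⟩ := ih'.2 h e
        obtain ⟨l₂, h₂, e₂, k₂⟩ := ih.2 h₁ e₁
        exact ⟨l₂, h₂, e₂, k₁.trans k₂⟩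
  exact (aux _ _ (Quot.eqvGen_exact hmm)).1 h e

theorem surjective (hp : p.IsCovering) (hY : Y.IsConnected) (hX : X.IsConnected) (x : X.Vertex) :
    ∃ y, p.toFun y = x := by
  obtain ⟨y⟩ := hY.1
  obtain ⟨g⟩ := hX.2 (p.toFun y) x
  induction g using PathClass.ind with
  | h l hl =>
    obtain ⟨_, y', -, -, h⟩ := hp.exists_walk hl
    exact ⟨y', h⟩

theorem of_comp (hp : p.IsCovering) {π : CubeMap Z Y} {q : CubeMap Z X} (hq : q.IsCovering)
    (h : p.comp π = q) : π.IsCovering := by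
  have e : ∀ {n : ℕ} (c : Z.cube n), p.toFun (π.toFun c) = q.toFun c := fun c => congr_toFun h c
  intro z n c hc
  obtain ⟨c', h1, h2⟩ := hq.exists_lift z (p.toFun c) (by rw [← p.origin_toFun, hc, e])
  refine ⟨c', ⟨h1, hp.eq_of_eq ?_ ?_⟩, ?_⟩
  · rw [← π.origin_toFun, h1, hc]
  · rw [e, h2]
  · rintro c'' ⟨h3, rfl⟩
    exact hq.eq_of_eq (h3.trans h1.symm) (by rw [← e, h2])

/-- Uniqueness of lifts. -/
theorem lift_unique (hp : p.IsCovering) (hZ : Z.IsConnected) {φ ψ : CubeMap Z Y}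
    (h : p.comp φ = p.comp ψ) {z : Z.Vertex} (hz : φ.toFun z = ψ.toFun z) : φ = ψ := by
  have e : ∀ {n : ℕ} (c : Z.cube n), p.toFun (φ.toFun c) = p.toFun (ψ.toFun c) :=
    fun c => congr_toFun h c
  have hv : ∀ z' : Z.Vertex, φ.toFun z' = ψ.toFun z' := by
    intro z'
    obtain ⟨g⟩ := hZ.2 z z'
    induction g using PathClass.ind with
    | h l hl =>
      refine (hp.walk_unique (φ.isWalk hl) (by rw [hz]; exact ψ.isWalk hl) ?_).2
      simp only [List.map_map]
      exact List.map_congr_left fun d _ => e d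
  ext n c
  exact hp.eq_of_eq (by rw [← φ.origin_toFun, ← ψ.origin_toFun, hv]) (e c)

/-- Existence of lifts from simply connected complexes. -/
theorem exists_lift_map (hp : p.IsCovering) (hZ : Z.IsSimplyConnected) (q : CubeMap Z X)
    (z₀ : Z.Vertex) (y₀ : Y.Vertex) (h₀ : q.toFun z₀ = p.toFun y₀) :
    ∃ π : CubeMap Z Y, p.comp π = q ∧ π.toFun z₀ = y₀ := by
  -- The lift on vertices, as a relation: map a path from `z₀` to `X` and lift it from `y₀`. It is
  -- single-valued because paths in `Z` with the same ends are homotopic and homotopies lift.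
  let R : Z.Vertex → Y.Vertex → Prop := fun z y => ∃ l l', IsWalk z₀ l z ∧ IsWalk y₀ l' y ∧
    l.map q.toFun = l'.map p.toFun
  have exR : ∀ z, ∃ y, R z y := by
    intro z
    obtain ⟨g⟩ := hZ.1.2 z₀ z
    induction g using PathClass.ind with
    | h l hl =>
      have := q.isWalk hl
      rw [h₀] at this
      obtain ⟨l', y, h1, h2, -⟩ := hp.exists_walk this
      exact ⟨y, l, l', hl, h1, h2.symm⟩
  have unR : ∀ {z y y'}, R z y → R z y' → y = y' := by
    rintro z y y' ⟨l, l', h1, h2, h3⟩ ⟨k, k', h4, h5, h6⟩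
    have e : PathClass.mk l h1 = PathClass.mk k h4 := hZ.mk_eq _ _
    have e' : PathClass.mk (l.map q.toFun) (q.isWalk h1)
        = PathClass.mk (k.map q.toFun) (q.isWalk h4) :=
      congrArg q.pathMap e
    obtain ⟨t, h7, h8, -⟩ := hp.lift_homotopy h₀.symm e' h2 h3.symm
    exact (hp.walk_unique h7 h5 (h8.trans h6)).2
  choose v hv using exR
  have hpv : ∀ z, p.toFun (v z) = q.toFun z := by
    intro z
    obtain ⟨l, l', h1, h2, h3⟩ := hv z
    have h4 := q.isWalk h1
    rw [h₀, h3] at h4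
    exact (p.isWalk h2).end_unique h4
  have hdart : ∀ d : Z.Dart, ∃ d' : Y.Dart, src d' = v (src d) ∧ tgt d' = v (tgt d) ∧
      p.toFun d' = q.toFun d := by
    intro d
    obtain ⟨d', h1, h2⟩ := hp.exists_dart (v (src d)) (q.toFun d) (by rw [hpv, q.src_toFun])
    refine ⟨d', h1, unR ?_ (hv _), h2⟩
    obtain ⟨l, l', h3, h4, h5⟩ := hv (src d)
    exact ⟨l ++ [d], l' ++ [d'], (isWalk_append _ _).2 ⟨_, h3, rfl, rfl⟩,
      (isWalk_append _ _).2 ⟨_, h4, h1, rfl⟩, by simp [h5, h2]⟩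
  have hcube : ∀ {n : ℕ} (c : Z.cube n), ∃ c' : Y.cube n, origin c' = v (origin c) ∧
      p.toFun c' = q.toFun c := fun c => hp.exists_lift _ _ (by rw [hpv, q.origin_toFun])
  choose F hF using @hcube
  have hcorner : ∀ {n : ℕ} (c : Z.cube n) (x : Fin n → Bool),
      corner (F c) x = v (corner c x) := by
    intro n c
    refine hypercube_induction (hF c).1 ?_
    intro x i ih
    obtain ⟨d', h1, h2, h3⟩ := hdart (edge c x i)
    have : edge (F c) x i = d' := hp.dart_eq (by rw [src_edge, ih, h1, src_edge])
      (by rw [p.edge_toFun, (hF c).2, h3, q.edge_toFun])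
    rw [← tgt_edge, this, h2, tgt_edge]
  refine ⟨⟨F, ?_⟩, ?_, ?_⟩
  · intro m n f c
    refine hp.eq_of_eq ?_ ?_
    · rw [(hF _).1]
      unfold origin
      rw [corner_map, corner_map, hcorner]
    · rw [(hF _).2, p.naturality, q.naturality, (hF c).2]
  · ext n c
    exact (hF c).2
  · have h1 := (hF z₀).1
    rw [origin_vertex, origin_vertex] at h1
    change F z₀ = y₀
    rw [h1]
    exact unR (hv _) ⟨[], [], rfl, rfl, rfl⟩

end IsCovering

end CubeMap

/-! ### Faces of the standard cube -/

namespace CubeHom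

theorem exists_eq_update_of_hammingDist {n : ℕ} {x y : Fin n → Bool} (h : hammingDist x y = 1) :
    ∃ j, y = Function.update x j (!x j) := by
  unfold hammingDist at h
  rw [Finset.card_eq_one] at h
  obtain ⟨j, hj⟩ := h
  refine ⟨j, funext fun k => ?_⟩
  have := Finset.ext_iff.1 hj k
  simp only [Finset.mem_filter, Finset.mem_univ, true_and, Finset.mem_singleton] at this
  by_cases hk : k = j
  · subst hk
    have h1 : x k ≠ y k := this.2 rfl
    cases hx : x k <;> cases hy : y k <;> simp_all
  · rw [Function.update_of_ne hk]
    by_contra h2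
    exact hk (this.1 (Ne.symm h2))

theorem exists_comp_edge {m n : ℕ} (f : CubeHom m n) (x : Fin m → Bool) (i : Fin m) :
    ∃ j, f.toFun (Function.update x i (!x i)) = Function.update (f.toFun x) j (!f.toFun x j) ∧
      ∀ t, (f.comp (edge x i)).toFun t = (edge (f.toFun x) j).toFun t := by
  obtain ⟨j, hj⟩ := exists_eq_update_of_hammingDist (x := f.toFun x)
    (y := f.toFun (Function.update x i (!x i))) (by rw [f.isometry, hammingDist_update_not])
  refine ⟨j, hj, fun t => ?_⟩
  simp only [comp, edge]
  split
  · exact hj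
  · rfl

/-- The square of the `n`-cube at the vertex `x` in the directions `i`, `j`. -/
def square {n : ℕ} (x : Fin n → Bool) (i j : Fin n) (hij : i ≠ j) : CubeHom 2 n where
  toFun t k := if k = i then xor (x i) (t 0) else if k = j then xor (x j) (t 1) else x k
  isometry s t := by
    have hinj : Function.Injective ![i, j] := by
      intro a b
      fin_cases a <;> fin_cases b <;> simp [hij, hij.symm]
    unfold hammingDist
    rw [← Finset.card_image_of_injective _ hinj]
    congr 1
    ext k
    simp only [Finset.mem_filter, Finset.mem_univ, true_and, Finset.mem_image, Fin.exists_fin_two]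
    by_cases h1 : k = i
    · subst h1
      simp [hij.symm]
    · by_cases h2 : k = j
      · subst h2
        simp [h1, hij]
      · simp [h1, h2, Ne.symm h1, Ne.symm h2]

/-- The face of the `(n+1)`-cube on which the first coordinate is `false`. -/
def face (n : ℕ) : CubeHom n (n + 1) where
  toFun t := Fin.cons false t
  isometry s t := by
    unfold hammingDist
    rw [← Finset.card_image_of_injective _ (Fin.succ_injective n)]
    congr 1
    ext k
    refine Fin.cases ?_ (fun k => ?_) k
    · simp [Fin.succ_ne_zero]
    · simp [Fin.succ_inj]

end CubeHom

namespace CubeComplex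

variable {X : CubeComplex.{u}}

theorem sq_of_cube {n : ℕ} (c : X.cube n) (x : Fin n → Bool) {i j : Fin n} (hij : i ≠ j) :
    Sq (edge c x i) (edge c (Function.update x i (!x i)) j) (edge c x j)
      (edge c (Function.update x j (!x j)) i) := by
  refine ⟨X.map (CubeHom.square x i j hij) c, ?_, ?_, ?_, ?_⟩
  all_goals
    apply edge_map
    intro t
    funext k
    by_cases h1 : k = i
    · subst h1
      cases ht : t 0 <;> simp [CubeHom.comp, CubeHom.edge, CubeHom.square, ht, hij]
    · by_cases h2 : k = j
      · subst h2
        cases ht : t 0 <;> simp [CubeHom.comp, CubeHom.edge, CubeHom.square, ht, h1]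
      · cases ht : t 0 <;> simp [CubeHom.comp, CubeHom.edge, CubeHom.square, ht, h1, h2]

/-! ### The universal cover -/

/-- The vertices of the universal cover: homotopy classes of edge paths starting at `x`. -/
abbrev Pt (x : X.Vertex) : Type u := Σ v : X.Vertex, PathClass x v

namespace Pt

variable {x : X.Vertex}

/-- The class `y'` is the class `y` followed by the edge path `l`. -/
def Reach (y : Pt x) (l : List X.Dart) (y' : Pt x) : Prop :=
  ∃ h : IsWalk y.1 l y'.1, y'.2 = y.2.comp (PathClass.mk l h)

theorem Reach.append {y y' y'' : Pt x} {l l' : List X.Dart} (h : Reach y l y')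
    (h' : Reach y' l' y'') : Reach y (l ++ l') y'' := by
  obtain ⟨h1, h2⟩ := h
  obtain ⟨h3, h4⟩ := h'
  refine ⟨(isWalk_append _ _).2 ⟨_, h1, h3⟩, ?_⟩
  rw [PathClass.mk_append h1 h3, h4, h2, PathClass.comp_assoc]

theorem Reach.unique {y y' y'' : Pt x} {l : List X.Dart} (h : Reach y l y')
    (h' : Reach y l y'') : y' = y'' := by
  obtain ⟨v', g'⟩ := y'
  obtain ⟨v'', g''⟩ := y''
  obtain ⟨h1, h2⟩ := h
  obtain ⟨h3, h4⟩ := h'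
  obtain rfl : v' = v'' := h1.end_unique h3
  simp only at h2 h4
  rw [h2, h4]

theorem Reach.of_move {y y' : Pt x} {l l' : List X.Dart} (h : Reach y l y')
    (w : IsWalk y.1 l' y'.1) (m : Move l l' ∨ Move l' l) : Reach y l' y' := by
  obtain ⟨h1, h2⟩ := h
  refine ⟨w, h2.trans ?_⟩
  rcases m with m | m
  · rw [PathClass.sound h1 w m]
  · rw [PathClass.sound w h1 m]

theorem reach_nil (y : Pt x) : Reach y [] y := ⟨rfl, (PathClass.comp_refl _).symm⟩

theorem exists_reach (y : Pt x) (d : X.Dart) (h : src d = y.1) : ∃ y', Reach y [d] y' :=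
  ⟨⟨tgt d, y.2.comp (PathClass.mk [d] ⟨h, rfl⟩)⟩, ⟨h, rfl⟩, rfl⟩

theorem Reach.rev {y y' : Pt x} {d : X.Dart} (h : Reach y [d] y') : Reach y' [rev d] y := by
  obtain ⟨y'', h'⟩ := exists_reach y' (CubeComplex.rev d) (by rw [src_rev]; exact h.1.2)
  have h2 := h.append h'
  have e : y''.1 = y.1 := by
    rw [← show tgt (CubeComplex.rev d) = y''.1 from h'.1.2, tgt_rev]
    exact h.1.1
  have h3 : Reach y [] y'' := h2.of_move e.symm (Or.inl (Move.backtrack [] [] d))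
  rwa [h3.unique (reach_nil y)] at h'

theorem Reach.sq {y y₁ y₃ y₄ : Pt x} {a b c d : X.Dart} (s : Sq a b c d) (h1 : Reach y [a] y₁)
    (h2 : Reach y [c] y₃) (h3 : Reach y₃ [d] y₄) : Reach y₁ [b] y₄ := by
  obtain ⟨y', h'⟩ := exists_reach y₁ b (by rw [s.src_right]; exact h1.1.2)
  have h4 : Reach y [a, b] y' := h1.append h'
  have h5 : Reach y [c, d] y₄ := h2.append h3
  have h6 : Reach y [a, b] y₄ := h5.of_move ((Eqv.swap_head s.swap []).isWalk h5.1)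
    (Or.inr (move_of_sq s []))
  rwa [h4.unique h6] at h'

end Pt

/-- `F` is a lift of the vertices of the cube `c` to the universal cover. -/
structure IsLift (x : X.Vertex) {n : ℕ} (c : X.cube n) (F : (Fin n → Bool) → Pt x) : Prop where
  fst_eq : ∀ u, (F u).1 = corner c u
  step : ∀ u i, Pt.Reach (F u) [edge c u i] (F (Function.update u i (!u i)))

theorem IsLift.map {x : X.Vertex} {m n : ℕ} (f : CubeHom m n) {c : X.cube n}
    {F : (Fin n → Bool) → Pt x} (h : IsLift x c F) : IsLift x (X.map f c) (F ∘ f.toFun) where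
  fst_eq u := by rw [corner_map]; exact h.fst_eq _
  step u i := by
    obtain ⟨j, h1, h2⟩ := f.exists_comp_edge u i
    rw [edge_map f c u i _ j h2, Function.comp_apply, Function.comp_apply, h1]
    exact h.step _ _

theorem IsLift.unique {x : X.Vertex} {n : ℕ} {c : X.cube n} {F F' : (Fin n → Bool) → Pt x}
    (h : IsLift x c F) (h' : IsLift x c F') (h0 : F (fun _ => false) = F' fun _ => false) :
    F = F' := by
  funext u
  refine hypercube_induction (P := fun u => F u = F' u) h0 ?_ u
  intro u i hu
  have := h.step u i
  rw [hu] at this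
  exact this.unique (h'.step u i)

/-- By induction on the dimension: lift one facet, then extend its vertices along the edges to the
opposite facet. The squares between the two facets make the second family compatible as well. -/
theorem exists_isLift {x : X.Vertex} {n : ℕ} (c : X.cube n) (y : Pt x) (hy : y.1 = origin c) :
    ∃ F, IsLift x c F ∧ F (fun _ => false) = y := by
  induction n with
  | zero =>
    refine ⟨fun _ => y, ⟨fun u => ?_, fun u i => i.elim0⟩, rfl⟩
    rw [hy, origin_vertex, corner_vertex]
  | succ n ih =>
    have z : (Fin.cons false (fun _ => false) : Fin (n + 1) → Bool) = fun _ => false := by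
      funext i
      refine Fin.cases rfl (fun _ => rfl) i
    obtain ⟨F₀, hF₀, h0⟩ := ih (X.map (CubeHom.face n) c) (by
      rw [hy]
      unfold origin
      rw [corner_map]
      congr 1
      exact z.symm)
    have hG : ∀ t, ∃ y', Pt.Reach (F₀ t) [edge c (Fin.cons false t) 0] y' := fun t =>
      Pt.exists_reach _ _ (by rw [src_edge, hF₀.fst_eq, corner_map]; rfl)
    choose G hG using hG
    have eup : ∀ (b : Bool) (t : Fin n → Bool) (i : Fin n),
        Function.update (Fin.cons b t : Fin (n + 1) → Bool) i.succ (!t i)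
          = Fin.cons b (Function.update t i (!t i)) := by
      intro b t i
      rw [Fin.cons_update]
    have e0 : ∀ (b b' : Bool) (t : Fin n → Bool),
        Function.update (Fin.cons b t : Fin (n + 1) → Bool) 0 b' = Fin.cons b' t := by
      intro b b' t
      rw [Fin.update_cons_zero]
    have hF₀' : ∀ t i, Pt.Reach (F₀ t) [edge c (Fin.cons false t) (Fin.succ i)]
        (F₀ (Function.update t i (!t i))) := by
      intro t i
      have := hF₀.step t i
      rwa [edge_map (CubeHom.face n) c t i (Fin.cons false t) i.succ] at this
      intro s
      cases hs : s 0
      · simp [CubeHom.comp, CubeHom.edge, CubeHom.face, hs]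
      · simp [CubeHom.comp, CubeHom.edge, CubeHom.face, hs]
    let F : (Fin (n + 1) → Bool) → Pt x := fun u =>
      if u 0 then G (Fin.tail u) else F₀ (Fin.tail u)
    have Ff : ∀ t, F (Fin.cons false t) = F₀ t := fun t => by simp [F]
    have Ft : ∀ t, F (Fin.cons true t) = G t := fun t => by simp [F]
    refine ⟨F, ⟨fun u => ?_, fun u i => ?_⟩, ?_⟩
    · rw [← Fin.cons_self_tail u]
      cases u 0
      · rw [Ff, hF₀.fst_eq, corner_map]
        rfl
      · rw [Ft, ← show _ = _ from (hG (Fin.tail u)).1.2, tgt_edge, Fin.cons_zero, e0]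
        rfl
    · rw [← Fin.cons_self_tail u]
      generalize Fin.tail u = t
      cases u 0
      · refine Fin.cases ?_ (fun i => ?_) i
        · rw [Fin.cons_zero, e0, Ff]
          exact (Ft t).symm ▸ hG t
        · rw [Fin.cons_succ, eup, Ff, Ff]
          exact hF₀' t i
      · refine Fin.cases ?_ (fun i => ?_) i
        · rw [Fin.cons_zero, e0, Ft, Bool.not_true, Ff]
          have := (hG t).rev
          rwa [rev_edge, Fin.cons_zero, e0] at this
        · rw [Fin.cons_succ, eup, Ft, Ft]
          have s := sq_of_cube c (Fin.cons false t) (i := 0) (j := i.succ)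
            (Fin.succ_ne_zero i).symm
          rw [Fin.cons_zero, Fin.cons_succ, eup, e0] at s
          exact Pt.Reach.sq s (hG t) (hF₀' t i) (hG _)
    · rw [← z, Ff, h0]

/-- The universal cover of the component of `x`. -/
def univCover (X : CubeComplex.{u}) (x : X.Vertex) : CubeComplex.{u} where
  cube n := {q : X.cube n × ((Fin n → Bool) → Pt x) // IsLift x q.1 q.2}
  map f q := ⟨(X.map f q.1.1, q.1.2 ∘ f.toFun), q.2.map f⟩
  map_id _ := Subtype.ext (Prod.ext (X.map_id _) rfl)
  map_comp g f _ := Subtype.ext (Prod.ext (X.map_comp g f _) rfl)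
  free s q h := X.free s q.1.1 (congrArg (fun q => q.1.1) h)

namespace univCover

variable {x : X.Vertex}

/-- The covering map. -/
def proj (x : X.Vertex) : CubeMap (univCover X x) X where
  toFun q := q.1.1
  naturality _ _ := rfl

/-- The path class that belongs to a vertex. -/
def pt (v : (univCover X x).Vertex) : Pt x := v.1.2 fun _ => false

theorem pt_fst (v : (univCover X x).Vertex) : (pt v).1 = (proj x).toFun v := by
  rw [pt, v.2.fst_eq, corner_vertex]
  rfl

theorem pt_injective : Function.Injective (pt : (univCover X x).Vertex → Pt x) := by
  intro v w h
  refine Subtype.ext (Prod.ext ?_ ?_)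
  · change (proj x).toFun v = (proj x).toFun w
    rw [← pt_fst, ← pt_fst, h]
  · funext u
    rw [Subsingleton.elim u fun _ => false]
    exact h

theorem pt_surjective : Function.Surjective (pt : (univCover X x).Vertex → Pt x) := fun y =>
  ⟨⟨(y.1, fun _ => y), ⟨fun _ => (corner_vertex _ _).symm, fun _ i => i.elim0⟩⟩, rfl⟩

theorem reach_dart (d : (univCover X x).Dart) :
    Pt.Reach (pt (src d)) [(proj x).toFun d] (pt (tgt d)) := by
  have h := d.2.step (fun _ => false) 0
  have e1 : edge d.1.1 (fun _ => false) 0 = (proj x).toFun d := by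
    change X.map _ d.1.1 = d.1.1
    conv_rhs => rw [← X.map_id d.1.1]
    congr 1
    ext t i
    rw [Subsingleton.elim i 0]
    cases h : t 0 <;> simp [CubeHom.edge, CubeHom.id, h]
  have e2 : Function.update (fun _ => false : Fin 1 → Bool) 0 (!false) = fun _ => true := by
    decide
  rw [e1, e2] at h
  exact h

theorem reach_walk {v w : (univCover X x).Vertex} {l : List (univCover X x).Dart}
    (h : IsWalk v l w) : Pt.Reach (pt v) (l.map (proj x).toFun) (pt w) := by
  induction l generalizing v with
  | nil =>
    obtain rfl : v = w := h
    exact Pt.reach_nil _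
  | cons d l ih =>
    have := reach_dart d
    rw [h.1] at this
    exact this.append (ih h.2)

theorem isCovering : (proj x).IsCovering := by
  intro v n c hc
  obtain ⟨F, hF, h0⟩ := exists_isLift c (pt v) (by rw [pt_fst, hc])
  refine ⟨⟨(c, F), hF⟩, ⟨pt_injective h0, rfl⟩, ?_⟩
  rintro ⟨⟨c', F'⟩, hF'⟩ ⟨h1, h2⟩
  obtain rfl : c' = c := h2
  have : F' = F := hF'.unique hF (h0.symm ▸ congrArg pt h1)
  subst this
  rfl

theorem exists_walk_of_reach {v w : (univCover X x).Vertex} {l : List X.Dart}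
    (h : Pt.Reach (pt v) l (pt w)) : ∃ l', IsWalk v l' w ∧ l'.map (proj x).toFun = l := by
  have h1 := h.1
  rw [pt_fst v] at h1
  obtain ⟨l', w', h2, rfl, -⟩ := isCovering.exists_walk h1
  have := (reach_walk h2).unique h
  rw [pt_injective this] at h2
  exact ⟨l', h2, rfl⟩

theorem isSimplyConnected (x : X.Vertex) : (univCover X x).IsSimplyConnected := by
  obtain ⟨v₀, hv₀⟩ := pt_surjective (⟨x, PathClass.refl x⟩ : Pt x)
  have reach : ∀ w, Nonempty (PathClass v₀ w) := by
    intro w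
    have : ∃ l, Pt.Reach (pt v₀) l (pt w) := by
      rw [hv₀]
      obtain ⟨z, g⟩ := pt w
      induction g using PathClass.ind with
      | h l hl => exact ⟨l, hl, (PathClass.refl_comp _).symm⟩
    obtain ⟨l, hl⟩ := this
    obtain ⟨l', h, -⟩ := exists_walk_of_reach hl
    exact ⟨PathClass.mk l' h⟩
  refine ⟨⟨⟨v₀⟩, fun v w => ?_⟩, fun v => ⟨fun g g' => ?_⟩⟩
  · obtain ⟨g⟩ := reach v
    obtain ⟨g'⟩ := reach w
    exact ⟨g.symm.comp g'⟩
  · suffices ∀ g : PathClass v v, g = PathClass.refl v by rw [this g, this g']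
    intro g
    induction g using PathClass.ind with
    | h l hl =>
      obtain ⟨h1, h2⟩ := reach_walk hl
      -- A closed path upstairs does not change the path class at its base point, so its projection
      -- is null-homotopic. Lifting that null-homotopy finishes the argument.
      have h3 : PathClass.mk _ h1 = PathClass.refl _ := by
        have := congrArg (PathClass.comp (pt v).2.symm) h2
        rw [← PathClass.comp_assoc, PathClass.symm_comp, PathClass.refl_comp] at this
        exact this.symm
      obtain ⟨l', h', e', h4⟩ := isCovering.lift_homotopy (pt_fst v).symm h3 hl rfl
      obtain rfl : l' = [] := by simpa using e'
      exact h4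

/-- The action of the fundamental group on the universal cover. -/
def act (g : X.Pi1 x) : CubeMap (univCover X x) (univCover X x) where
  toFun q := ⟨(q.1.1, fun u => ⟨(q.1.2 u).1, g.comp (q.1.2 u).2⟩), ⟨q.2.fst_eq, fun u i => by
    obtain ⟨h1, h2⟩ := q.2.step u i
    refine ⟨h1, ?_⟩
    simp only
    rw [h2, PathClass.comp_assoc]⟩⟩
  naturality _ _ := rfl

theorem act_mul (g h : X.Pi1 x) {n : ℕ} (c : (univCover X x).cube n) :
    (act (g * h)).toFun c = (act g).toFun ((act h).toFun c) := by
  refine Subtype.ext (Prod.ext rfl (funext fun u => ?_))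
  exact congrArg (Sigma.mk _) (PathClass.comp_assoc _ _ _)

theorem act_one {n : ℕ} (c : (univCover X x).cube n) : (act (1 : X.Pi1 x)).toFun c = c := by
  refine Subtype.ext (Prod.ext rfl (funext fun u => ?_))
  exact congrArg (Sigma.mk _) (PathClass.refl_comp _)

theorem act_inv_act (g : X.Pi1 x) {n : ℕ} (c : (univCover X x).cube n) :
    (act g⁻¹).toFun ((act g).toFun c) = c := by
  rw [← act_mul, inv_mul_cancel, act_one]

theorem pt_act (g : X.Pi1 x) (v : (univCover X x).Vertex) :
    pt ((act g).toFun v) = ⟨(pt v).1, g.comp (pt v).2⟩ := rfl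

/-- The fundamental group acts transitively on the fibres of the universal cover. -/
theorem exists_act_eq {v w : (univCover X x).Vertex} (h : (proj x).toFun v = (proj x).toFun w) :
    ∃ g : X.Pi1 x, (act g).toFun v = w := by
  rw [← pt_fst, ← pt_fst] at h
  suffices ∃ g : X.Pi1 x, (⟨(pt v).1, g.comp (pt v).2⟩ : Pt x) = pt w by
    obtain ⟨g, hg⟩ := this
    exact ⟨g, pt_injective hg⟩
  generalize pt v = a at *
  generalize pt w = b at *
  obtain ⟨a, s⟩ := a
  obtain ⟨b, t⟩ := b
  obtain rfl : a = b := h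
  refine ⟨t.comp s.symm, congrArg (Sigma.mk _) ?_⟩
  change (t.comp s.symm).comp s = t
  rw [PathClass.comp_assoc, PathClass.symm_comp, PathClass.comp_refl]

end univCover

end CubeComplex

/-! ### Embedded two-sided carriers exclude self-osculation -/

namespace CubeComplex

variable {X : CubeComplex.{u}}

/-- Lift `c` and `e` to edges dual to one hyperplane of the universal cover. Embeddedness of the
carrier gives a deck transformation in the stabilizer that matches their sources, and two-sidedness
makes it preserve the side. It therefore takes one lift to the other, because the universal cover
has only one dual edge per vertex and side. -/
theorem hasNoSelfOsculation (hX : X.IsNPC) (h : X.HasEmbeddedCarriers) :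
    X.HasNoSelfOsculation := by
  intro c e hce hsrc
  have hp : (univCover.proj (src c)).IsCovering := univCover.isCovering
  have hs := univCover.isSimplyConnected (src c)
  have hY := hp.isNPC hX
  obtain ⟨v, hv⟩ := univCover.pt_surjective (⟨src c, PathClass.refl _⟩ : Pt (src c))
  obtain ⟨c', hc', hc⟩ := hp.exists_dart v c (by rw [← univCover.pt_fst, hv])
  obtain ⟨e', he, hce'⟩ := hp.exists_dirParallel hce c' hc
  have carrier : ∀ d, DirParallel c' d → InCarrier c' (src d) := fun d hd =>
    ⟨1, d, CubeHom.vertex fun _ => false, rfl, fun _ => false, 0, Or.inl (by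
      have : edge d (fun _ => false) 0 = d := by
        unfold edge
        conv_rhs => rw [← CubeComplex.map_id _ d]
        congr 1
        ext t i
        rw [Subsingleton.elim i 0]
        cases h : t 0 <;> simp [CubeHom.edge, CubeHom.id, h]
      rwa [this])⟩
  obtain ⟨h1, h2⟩ := h _ _ ⟨hp, hs⟩ c'
  obtain ⟨g, hg, hpar, hgs⟩ := h1 0 (src c') (src e') (carrier _ (Relation.EqvGen.refl _))
    (carrier _ hce') (by rw [CubeMap.src_toFun, CubeMap.src_toFun, hc, he, hsrc])
  have h3 : e' = g.toFun c' := eq_of_dirParallel_of_isSimplyConnected hY hs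
    (Relation.EqvGen.trans _ _ _ (Relation.EqvGen.symm _ _ hce') (h2 g hg hpar))
    (by rw [← hgs, CubeMap.src_toFun])
  exact hc.symm.trans ((CubeMap.congr_toFun hg.2 c').symm.trans
    ((congrArg (univCover.proj (src c)).toFun h3.symm).trans he))

/-! ### Components and fibre products -/

theorem nonempty_pathClass_corner {v : X.Vertex} {n : ℕ} (c : X.cube n)
    (h : Nonempty (PathClass v (origin c))) (x : Fin n → Bool) :
    Nonempty (PathClass v (corner c x)) := by
  refine hypercube_induction (P := fun x => Nonempty (PathClass v (corner c x))) h ?_ x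
  rintro x i ⟨g⟩
  exact ⟨g.comp (PathClass.mk [edge c x i] ⟨src_edge _ _ _, tgt_edge _ _ _⟩)⟩

/-- The component of the vertex `v`. -/
def component (X : CubeComplex.{u}) (v : X.Vertex) : CubeComplex.{u} where
  cube n := {c : X.cube n // Nonempty (PathClass v (origin c))}
  map f c := ⟨X.map f c.1, by
    unfold origin
    rw [corner_map]
    exact nonempty_pathClass_corner c.1 c.2 _⟩
  map_id c := Subtype.ext (X.map_id c.1)
  map_comp g f c := Subtype.ext (X.map_comp g f c.1)
  free s c h := X.free s c.1 (congrArg Subtype.val h)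

namespace component

/-- The inclusion of a component. -/
def incl (v : X.Vertex) : CubeMap (component X v) X where
  toFun c := c.1
  naturality _ _ := rfl

/-- The base point of a component. -/
def base (v : X.Vertex) : (component X v).Vertex :=
  ⟨v, by rw [origin_vertex]; exact ⟨PathClass.refl v⟩⟩

theorem isCovering (v : X.Vertex) : (incl v).IsCovering := by
  intro y n c hc
  have hy := y.2
  rw [origin_vertex] at hy
  refine ⟨⟨c, ?_⟩, ⟨Subtype.ext hc, rfl⟩, ?_⟩
  · rw [hc]
    exact hy
  · rintro c' ⟨-, h⟩
    exact Subtype.ext h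

theorem isConnected (v : X.Vertex) : (component X v).IsConnected := by
  have reach : ∀ w, Nonempty (PathClass (base v) w) := by
    intro w
    have hw := w.2
    rw [origin_vertex] at hw
    obtain ⟨g⟩ := hw
    induction g using PathClass.ind with
    | h l hl =>
      obtain ⟨l', w', h1, -, h2⟩ := (isCovering v).exists_walk (y := base v) hl
      obtain rfl : w' = w := Subtype.ext h2
      exact ⟨PathClass.mk l' h1⟩
  refine ⟨⟨base v⟩, fun a b => ?_⟩
  obtain ⟨g⟩ := reach a
  obtain ⟨g'⟩ := reach b
  exact ⟨g.symm.comp g'⟩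

end component

end CubeComplex

/-! ### Elevations as components of fibre products -/

namespace CubeMap

variable {A X X' Y Z : CubeComplex.{u}}

theorem IsCovering.comp {p : CubeMap Y X} {q : CubeMap Z Y} (hp : p.IsCovering)
    (hq : q.IsCovering) : (p.comp q).IsCovering := by
  intro z n c hc
  obtain ⟨c₁, h1, h2⟩ := hp.exists_lift (q.toFun z) c hc
  obtain ⟨c₂, h3, h4⟩ := hq.exists_lift z c₁ h1
  refine ⟨c₂, ⟨h3, (congrArg p.toFun h4).trans h2⟩, ?_⟩
  rintro c₃ ⟨h5, h6⟩
  have h7 : p.toFun (q.toFun c₃) = c := h6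
  refine hq.eq_of_eq (h5.trans h3.symm) (hp.eq_of_eq ?_ ?_)
  · rw [← q.origin_toFun, ← q.origin_toFun, h5, h3]
  · rw [h7, h4, h2]

/-- The fibre product of two combinatorial maps. -/
def fibreProduct (f : CubeMap A X) (p : CubeMap X' X) : CubeComplex.{u} where
  cube n := {c : A.cube n × X'.cube n // f.toFun c.1 = p.toFun c.2}
  map g c := ⟨(A.map g c.1.1, X'.map g c.1.2), by
    rw [f.naturality, p.naturality, c.2]⟩
  map_id c := Subtype.ext (Prod.ext (A.map_id _) (X'.map_id _))
  map_comp g f c := Subtype.ext (Prod.ext (A.map_comp g f _) (X'.map_comp g f _))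
  free s c h := A.free s c.1.1 (congrArg (fun c => c.1.1) h)

/-- The first projection of the fibre product. -/
def fibreFst (f : CubeMap A X) (p : CubeMap X' X) : CubeMap (fibreProduct f p) A where
  toFun c := c.1.1
  naturality _ _ := rfl

/-- The second projection of the fibre product. -/
def fibreSnd (f : CubeMap A X) (p : CubeMap X' X) : CubeMap (fibreProduct f p) X' where
  toFun c := c.1.2
  naturality _ _ := rfl

theorem isCovering_fibreFst (f : CubeMap A X) {p : CubeMap X' X} (hp : p.IsCovering) :
    (fibreFst f p).IsCovering := by
  intro y n c hc
  have e : f.toFun (origin c) = p.toFun y.1.2 := by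
    rw [hc]
    exact y.2
  obtain ⟨c', h1, h2⟩ := hp.exists_lift y.1.2 (f.toFun c) (by rw [← f.origin_toFun, e])
  refine ⟨⟨(c, c'), h2.symm⟩, ⟨Subtype.ext (Prod.ext hc h1), rfl⟩, ?_⟩
  rintro c'' ⟨h3, h4⟩
  refine Subtype.ext (Prod.ext h4 (hp.eq_of_eq ?_ ?_))
  · rw [h1]
    exact congrArg (fun c => c.1.2) h3
  · rw [← c''.2, h2]
    exact congrArg f.toFun h4

/-- A loop of `A` lifts to a loop of the component exactly when its image in `X` lifts to a loop of
`X'`. By homotopy lifting the latter depends only on the class of the image, which gives the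
condition on `π₁`. -/
theorem isElevation_component (f : CubeMap A X) {p : CubeMap X' X} (hp : p.IsCovering)
    (b₀ : (fibreProduct f p).Vertex) :
    IsElevation f p ((fibreFst f p).comp (component.incl b₀))
      ((fibreSnd f p).comp (component.incl b₀)) where
  connected := component.isConnected b₀
  covering := (isCovering_fibreFst f hp).comp (component.isCovering b₀)
  comm := by
    ext n c
    exact c.1.2.symm
  pi1_eq b h := by
    have hq := (isCovering_fibreFst f hp).comp (component.isCovering b₀)
    ext g
    constructor
    · rintro ⟨m, rfl⟩
      refine ⟨((fibreSnd f p).comp (component.incl b₀)).pi1Map rfl m, ?_⟩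
      induction m using PathClass.ind with
      | h l hl =>
        refine congrArg (Quot.mk _) (Subtype.ext ?_)
        simp only [List.map_map]
        exact List.map_congr_left fun d _ => d.1.2.symm
    · rintro ⟨m, hm⟩
      induction g using PathClass.ind with
      | h l hl =>
      induction m using PathClass.ind with
      | h l₂ hl₂ =>
      obtain ⟨l', h1, h2, -⟩ := hp.lift_homotopy h hm hl₂ rfl
      obtain ⟨t, b', h3, rfl, h4⟩ := hq.exists_walk hl
      have h5 := hp.walk_unique h1 (((fibreSnd f p).comp (component.incl b₀)).isWalk h3) (by
        rw [h2]
        simp only [List.map_map]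
        exact List.map_congr_left fun d _ => d.1.2)
      obtain rfl : b' = b := Subtype.ext (Subtype.ext (Prod.ext h4 h5.2.symm))
      exact ⟨PathClass.mk t h3, rfl⟩

/-- The edges of the image of an elevation form a convex set. -/
theorem exists_convexSet_of_elevation {f : CubeMap A X} (hf : f.IsLocalIsometry)
    {p : CubeMap X' X} (hp : p.IsCovering) (hX' : X'.IsNPC)
    (hemb : ∀ (B : CubeComplex.{u}) (q : CubeMap B A) (f' : CubeMap B X'),
      IsElevation f p q f' → f'.IsEmbedding)
    (a : A.Vertex) (z : X'.Vertex) (haz : f.toFun a = p.toFun z) :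
    ∃ B : Set X'.Dart, IsConvexSet B ∧
      (∀ {l l' a' z'}, IsWalk a l a' → IsWalk z l' z' → l.map f.toFun = l'.map p.toFun →
        ∀ d ∈ l', d ∈ B) ∧
      (∀ {l' z'}, IsWalk z l' z' → (∀ d ∈ l', d ∈ B) → ∃ l a', IsWalk a l a' ∧
        l.map f.toFun = l'.map p.toFun ∧ (z' = z → a' = a)) := by
  let b₀ : (fibreProduct f p).Vertex := ⟨(a, z), haz⟩
  let q := (fibreFst f p).comp (component.incl b₀)
  let f' := (fibreSnd f p).comp (component.incl b₀)
  have hel : IsElevation f p q f' := isElevation_component f hp b₀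
  have he : f'.IsEmbedding := hemb _ q f' hel
  have hq : q.IsCovering := hel.covering
  have hcomm : ∀ {n : ℕ} (c : (component (fibreProduct f p) b₀).cube n),
      p.toFun (f'.toFun c) = f.toFun (q.toFun c) := fun c => congr_toFun hel.comm c
  refine ⟨Set.range f'.toFun, ⟨?_, ?_⟩, ?_, ?_⟩
  · rintro _ ⟨d, rfl⟩
    exact ⟨rev d, f'.rev_toFun d⟩
  · rintro _ b _ d ⟨a₁, rfl⟩ ⟨c₁, rfl⟩ s
    -- Embeddedness is essential: two edges of the image that meet in `X'` already meet in the
    -- elevation. Fullness of links then gives the square in `A`, which lifts to the elevation.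
    have hsrc : src a₁ = src c₁ := he 0 (by rw [f'.src_toFun, f'.src_toFun, s.src_eq])
    have s' := p.sq s
    rw [hcomm, hcomm] at s'
    obtain ⟨t, h1, -, h3, -⟩ := s'
    rw [zero_two] at h1 h3
    obtain ⟨t', ht', hax⟩ := hf.link_full (q.toFun (src a₁)) ![q.toFun a₁, q.toFun c₁] (by
        intro i
        fin_cases i
        · exact (q.src_toFun _).symm
        · change src (q.toFun c₁) = _
          rw [hsrc, q.src_toFun])
      ⟨t, by rw [← src_axis t 0, q.src_toFun, f.src_toFun, ← h1]; rfl, by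
        intro i
        fin_cases i
        · exact h1
        · exact h3⟩
    obtain ⟨r, hr, rfl⟩ := hq.exists_lift (src a₁) t' ht'
    have hr0 : axis r 0 = a₁ := hq.dart_eq (by rw [src_axis, hr])
      (by rw [q.axis_toFun, hax]; rfl)
    have hr1 : axis r 1 = c₁ := hq.dart_eq (by rw [src_axis, hr, hsrc])
      (by rw [q.axis_toFun, hax]; rfl)
    have sr : Sq a₁ (edge r ![true, false] 1) c₁ (edge r ![false, true] 0) :=
      ⟨r, by rw [zero_two]; exact hr0, rfl, by rw [zero_two]; exact hr1, rfl⟩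
    exact ⟨_, ((f'.sq sr).unique hX' s).1⟩
  · intro l l' a' z' hl hl' e
    obtain ⟨t, b, h1, rfl, -⟩ := hq.exists_walk (y := component.base b₀) hl
    have h2 := hp.walk_unique hl' (f'.isWalk h1) (by
      rw [← e]
      simp only [List.map_map]
      exact List.map_congr_left fun d _ => (hcomm d).symm)
    rw [h2.1]
    intro d hd
    rw [List.mem_map] at hd
    obtain ⟨d', -, rfl⟩ := hd
    exact ⟨d', rfl⟩
  · intro l' z' hl' hB
    have key : ∀ (l' : List X'.Dart) (b : (component (fibreProduct f p) b₀).Vertex),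
        IsWalk (f'.toFun b) l' z' → (∀ d ∈ l', d ∈ Set.range f'.toFun) →
        ∃ t b', IsWalk b t b' ∧ t.map f'.toFun = l' ∧ f'.toFun b' = z' := by
      intro l'
      induction l' with
      | nil =>
        intro b h _
        exact ⟨[], b, rfl, rfl, h⟩
      | cons d l' ih =>
        intro b h hB
        rw [List.forall_mem_cons] at hB
        obtain ⟨⟨d', rfl⟩, hB⟩ := hB
        have h1 : src d' = b := he 0 (by rw [f'.src_toFun, h.1])
        obtain ⟨t, b', h2, rfl, h3⟩ := ih (tgt d') (by rw [f'.tgt_toFun]; exact h.2) hB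
        exact ⟨d' :: t, b', ⟨h1, h2⟩, rfl, h3⟩
    obtain ⟨t, b', h1, rfl, h2⟩ := key l' (component.base b₀) hl' hB
    refine ⟨t.map q.toFun, q.toFun b', q.isWalk h1, ?_, ?_⟩
    · simp only [List.map_map]
      exact List.map_congr_left fun d _ => (hcomm d).symm
    · rintro rfl
      have : b' = component.base b₀ := he 0 h2
      rw [this]
      rfl

end CubeMap

/-! ### Shortest paths between convex subcomplexes, and parallel parts -/

namespace CubeComplex

variable {X Y Z : CubeComplex.{u}}

theorem length_nf_le (w : List X.Dart) : (nf w).length ≤ w.length := by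
  induction w with
  | nil => exact le_rfl
  | cons a w ih =>
    by_cases h : Starts (rev a) (nf w)
    · have := (nf_cons_of_starts h).length_eq
      simp at this ⊢
      omega
    · rw [nf_cons_of_not_starts h]
      simpa using ih

/-- Every cancellation in the computation of `nf` loses length, so here none occurs. -/
theorem red_of_length_le (hX : X.IsNPC) {w : List X.Dart} (h : w.length ≤ (nf w).length) :
    Red w := by
  suffices nf w = w by
    rw [← this]
    exact red_nf hX w
  induction w with
  | nil => rfl
  | cons a w ih =>
    have h1 := length_nf_le w
    by_cases hs : Starts (rev a) (nf w)
    · have := (nf_cons_of_starts hs).length_eq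
      simp at this h
      omega
    · rw [nf_cons_of_not_starts hs] at h ⊢
      rw [ih (by simpa using h)]

/-- The vertices that can be reached from `v` through edges of `D`. -/
def span (D : Set X.Dart) (v : X.Vertex) : Set X.Vertex :=
  {w | ∃ l, IsWalk v l w ∧ ∀ d ∈ l, d ∈ D}

theorem mem_span_self (D : Set X.Dart) (v : X.Vertex) : v ∈ span D v := ⟨[], rfl, by simp⟩

theorem mem_span_trans {D : Set X.Dart} {u v w : X.Vertex} (h : v ∈ span D u) (h' : w ∈ span D v) :
    w ∈ span D u := by
  obtain ⟨l, h1, h2⟩ := h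
  obtain ⟨l', h3, h4⟩ := h'
  refine ⟨l ++ l', (isWalk_append _ _).2 ⟨_, h1, h3⟩, fun d hd => ?_⟩
  rcases List.mem_append.1 hd with hd | hd
  · exact h2 d hd
  · exact h4 d hd

theorem IsConvexSet.mem_span_symm {D : Set X.Dart} (hD : IsConvexSet D) {v w : X.Vertex}
    (h : w ∈ span D v) : v ∈ span D w := by
  obtain ⟨l, h1, h2⟩ := h
  exact ⟨revList l, h1.revList, hD.mem_revList h2⟩

theorem span_mono {D E : Set X.Dart} (h : D ⊆ E) (v : X.Vertex) : span D v ⊆ span E v :=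
  fun _ ⟨l, h1, h2⟩ => ⟨l, h1, fun d hd => h (h2 d hd)⟩

theorem IsConvexSet.exists_red (hX : X.IsNPC) {D : Set X.Dart} (hD : IsConvexSet D)
    {v w : X.Vertex} (h : w ∈ span D v) : ∃ l, IsWalk v l w ∧ Red l ∧ ∀ d ∈ l, d ∈ D := by
  obtain ⟨l, h1, h2⟩ := h
  exact ⟨nf l, (PathClass.nf_spec h1).1, red_nf hX l, hD.nf_mem h2⟩

/-- A shortest edge path between two convex sets is reduced and meets the sets only in its
ends. -/
theorem IsConvexSet.red_of_minimal (hX : X.IsNPC) {D : Set X.Dart} {v : X.Vertex}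
    {S : Set X.Vertex} {n : ℕ}
    (hmin : ∀ {a b l}, a ∈ span D v → b ∈ S → IsWalk a l b → n ≤ l.length)
    {a b : X.Vertex} {l : List X.Dart} (ha : a ∈ span D v) (hb : b ∈ S) (hl : IsWalk a l b)
    (hn : l.length = n) : Red l ∧ ∀ d ∈ D, ¬ Starts d l := by
  refine ⟨red_of_length_le hX ?_, ?_⟩
  · rw [hn]
    exact hmin ha hb (PathClass.nf_spec hl).1
  · rintro d hd ⟨t, ht⟩
    have h1 := ht.isWalk hl
    have h2 : tgt d ∈ span D v := mem_span_trans ha ⟨[d], ⟨h1.1, rfl⟩, by simpa using hd⟩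
    have h3 := hmin h2 hb h1.2
    have h4 := ht.length_eq
    simp at h4
    omega

/-- An edge can be moved along an edge path whose edges can be translated across its hyperplane. -/
theorem exists_slide_of_mem_pull {π : CubeMap Y X} (hπ : π.IsCovering)
    (hos : X.HasNoSelfOsculation) {B : Set X.Dart} {c₀ : X.Dart} {α : List Y.Dart} :
    ∀ {c : Y.Dart} {w : Y.Vertex}, DirParallel c₀ (π.toFun c) → IsWalk (src c) α w →
    (∀ d ∈ α, π.toFun d ∈ pull c₀ B) → ∃ α' e, Slide c α α' e ∧ ∀ d ∈ α', π.toFun d ∈ B := by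
  induction α with
  | nil => exact fun {c w} _ _ _ => ⟨[], c, Slide.nil c, by simp⟩
  | cons a α ih =>
    intro c w hc hw hα
    rw [List.forall_mem_cons] at hα
    obtain ⟨⟨e, b, d, h1, h2, h3⟩, hα⟩ := hα
    obtain rfl : e = π.toFun c := hos _ _
      (Relation.EqvGen.trans _ _ _ (Relation.EqvGen.symm _ _ h1) hc)
      (by rw [← h2.src_eq, ← π.src_toFun, hw.1, π.src_toFun])
    obtain ⟨b', d', s, rfl, rfl⟩ := hπ.exists_sq_of_src_eq h2 hw.1
    obtain ⟨α', g, h4, h5⟩ := ih (c := b')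
      (Relation.EqvGen.trans _ _ _ hc (π.sq s).dirParallel) (by rw [s.src_right]; exact hw.2) hα
    exact ⟨d' :: α', g, Slide.cons s h4, by rw [List.forall_mem_cons]; exact ⟨h3, h5⟩⟩

/-- Slide the edges of `γ` along `α` in turn. A map over `X` from `v` to `w` must take `γ` to the
slid path `γ'`: corresponding edges have parallel images with the same source, which agree by `hos`.
-/
theorem exists_translate_of_mem_pullAll {π : CubeMap Y X} (hπ : π.IsCovering)
    (hos : X.HasNoSelfOsculation) {B : Set X.Dart} {γ : List Y.Dart} :
    ∀ {v w u : Y.Vertex} {α : List Y.Dart}, IsWalk v γ u → IsWalk v α w →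
    (∀ d ∈ α, π.toFun d ∈ pullAll (γ.map π.toFun) B) →
    ∃ α' γ' u', IsWalk u α' u' ∧ IsWalk w γ' u' ∧ γ'.length = γ.length ∧
      (∀ d ∈ α', π.toFun d ∈ B) ∧
      ∀ φ : CubeMap Y Y, π.comp φ = π → φ.toFun v = w → φ.toFun u = u' := by
  induction γ with
  | nil =>
    intro v w u α hγ hα hB
    obtain rfl : v = u := hγ
    exact ⟨α, [], w, hα, rfl, rfl, hB, fun φ _ h => h⟩
  | cons c γ ih =>
    rintro v w u α ⟨rfl, hγ⟩ hα hB
    obtain ⟨α₁, e, h1, h2⟩ := exists_slide_of_mem_pull hπ hos (Relation.EqvGen.refl _) hα hB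
    obtain ⟨α', γ', u', h3, h4, h5, h6, h7⟩ := ih hγ h1.isWalk h2
    have hsrc := h1.src_eq hα
    refine ⟨α', e :: γ', u', h3, ⟨hsrc, h4⟩, by simp [h5], h6, fun φ hφ hv => h7 φ hφ ?_⟩
    have hφ' : π.toFun (φ.toFun c) = π.toFun c := CubeMap.congr_toFun hφ c
    have : φ.toFun c = e := by
      refine hπ.dart_eq (by rw [← φ.src_toFun, hv, hsrc]) (hφ'.trans ?_)
      refine hos _ _ (π.slide h1).dirParallel ?_
      rw [← hφ', ← π.src_toFun, ← π.src_toFun, ← φ.src_toFun, hv, hsrc]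
    rw [φ.tgt_toFun, this]

theorem map_mem_span {π : CubeMap Y X} {φ : CubeMap Y Y} (hφ : π.comp φ = π) {Q : Set X.Dart}
    {v w : Y.Vertex} (h : w ∈ span {d | π.toFun d ∈ Q} v) :
    φ.toFun w ∈ span {d | π.toFun d ∈ Q} (φ.toFun v) := by
  obtain ⟨l, h1, h2⟩ := h
  refine ⟨l.map φ.toFun, φ.isWalk h1, fun d hd => ?_⟩
  rw [List.mem_map] at hd
  obtain ⟨e, he, rfl⟩ := hd
  have : π.toFun (φ.toFun e) = π.toFun e := CubeMap.congr_toFun hφ e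
  rw [Set.mem_ofPred_eq, this]
  exact h2 e he

/-- The part of a convex set that is parallel to another convex set. -/
theorem exists_parallel_part {π : CubeMap Y X} (hπ : π.IsCovering) (hX : X.IsNPC)
    (hY : Y.IsSimplyConnected) (hos : X.HasNoSelfOsculation) {Q B : Set X.Dart}
    (hQ : IsConvexSet Q) (hB : IsConvexSet B) (v u : Y.Vertex) :
    ∃ Q₂ ⊆ Q, IsConvexSet Q₂ ∧ ∃ v₂ ∈ span {d | π.toFun d ∈ Q} v,
      (∀ φ : CubeMap Y Y,
        (∀ y ∈ span {d | π.toFun d ∈ Q} v, φ.toFun y ∈ span {d | π.toFun d ∈ Q} v) →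
        (∀ y ∈ span {d | π.toFun d ∈ B} u, φ.toFun y ∈ span {d | π.toFun d ∈ B} u) →
        ∀ y ∈ span {d | π.toFun d ∈ Q₂} v₂, φ.toFun y ∈ span {d | π.toFun d ∈ Q₂} v₂) ∧
      (∀ φ : CubeMap Y Y, π.comp φ = π → φ.toFun v₂ ∈ span {d | π.toFun d ∈ Q₂} v₂ →
        φ.toFun u ∈ span {d | π.toFun d ∈ B} u) := by
  classical
  have hYn := hπ.isNPC hX
  set D : Set Y.Dart := {d | π.toFun d ∈ Q} with hD
  set E : Set Y.Dart := {d | π.toFun d ∈ B} with hE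
  have hDc : IsConvexSet D := π.isConvexSet_preimage hQ
  have hEc : IsConvexSet E := π.isConvexSet_preimage hB
  have hex : ∃ n, ∃ a ∈ span D v, ∃ b ∈ span E u, ∃ l, IsWalk a l b ∧ l.length = n := by
    obtain ⟨g⟩ := hY.1.2 v u
    induction g using PathClass.ind with
    | h l hl => exact ⟨_, v, mem_span_self _ _, u, mem_span_self _ _, l, hl, rfl⟩
  obtain ⟨v₂, hv₂, u₂, hu₂, γ, hγ, hγn⟩ := Nat.find_spec hex
  have hmin : ∀ {a b l}, a ∈ span D v → b ∈ span E u → IsWalk a l b →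
      Nat.find hex ≤ l.length := fun ha hb hl => Nat.find_min' hex ⟨_, ha, _, hb, _, hl, rfl⟩
  generalize Nat.find hex = n at *
  have hmin' : ∀ {a b l}, a ∈ span E u → b ∈ span D v → IsWalk a l b → n ≤ l.length := by
    intro a b l ha hb hl
    have := hmin hb ha hl.revList
    rwa [length_revList] at this
  -- The path `γ` is a shortest one between the two subcomplexes. The new set is defined by its
  -- image downstairs, so it is a subset of the edges of `X`.
  have hQ₂ : IsConvexSet (Q ∩ pullAll (γ.map π.toFun) B) := hQ.inter (hB.pullAll hX hos _)
  refine ⟨Q ∩ pullAll (γ.map π.toFun) B, Set.inter_subset_left, hQ₂, v₂, hv₂, ?_, ?_⟩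
  · rintro φ hφD hφE y ⟨α, hα, hαQ⟩
    obtain ⟨α', γ', u', h1, h2, h3, h4, -⟩ := exists_translate_of_mem_pullAll hπ hos hγ hα
      fun d hd => (hαQ d hd).2
    have hy : φ.toFun y ∈ span D v :=
      hφD _ (mem_span_trans hv₂ ⟨α, hα, fun d hd => (hαQ d hd).1⟩)
    have hu' : φ.toFun u' ∈ span E u := hφE _ (mem_span_trans hu₂ ⟨α', h1, h4⟩)
    obtain ⟨β, hβ, hβr, hβE⟩ := hEc.exists_red hYn
      (mem_span_trans (hEc.mem_span_symm hu₂) hu')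
    obtain ⟨δ, hδ, hδr, hδD⟩ := hDc.exists_red hYn
      (mem_span_trans (hDc.mem_span_symm hv₂) hy)
    have hγ' := φ.isWalk h2
    have m1 := IsConvexSet.red_of_minimal hYn hmin hv₂ hu₂ hγ hγn
    have m2 := IsConvexSet.red_of_minimal hYn hmin hy hu' hγ' (by simp [h3, hγn])
    have m3 := IsConvexSet.red_of_minimal hYn hmin' hu₂ hv₂ hγ.revList
      (by rw [length_revList, hγn])
    -- The image of `γ'` under `φ` is again a shortest path between the subcomplexes. It bounds a
    -- quadrilateral with `γ`, and the product region shows that `δ` can be pushed into `B`.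
    obtain ⟨δ', h5, h6⟩ := hDc.exists_slideAll hYn hEc hδr hδD hβr hβE m1.1 m1.2 m3.2 m2.1 m2.2
      (by simp [h3]) ((isWalk_append _ _).2 ⟨_, hδ, hγ'⟩) ((isWalk_append _ _).2 ⟨_, hγ, hβ⟩)
      (hY.mk_eq _ _)
    have h7 := (π.slideAll h5).mem_pullAll (B := B) (by
      intro d hd
      rw [List.mem_map] at hd
      obtain ⟨e, he, rfl⟩ := hd
      exact h6 e he)
    exact ⟨δ, hδ, fun d hd => ⟨hδD d hd, h7 _ (List.mem_map_of_mem hd)⟩⟩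
  · rintro φ hφ ⟨α, hα, hαQ⟩
    obtain ⟨α', γ', u', h1, h2, h3, h4, h5⟩ := exists_translate_of_mem_pullAll hπ hos hγ hα
      fun d hd => (hαQ d hd).2
    have h6 : φ.toFun u₂ ∈ span E u := by
      rw [h5 φ hφ rfl]
      exact mem_span_trans hu₂ ⟨α', h1, h4⟩
    exact mem_span_trans h6 (map_mem_span hφ (hEc.mem_span_symm hu₂))

end CubeComplex

/-! ### Conjugates of `π₁A` and the action on the universal cover -/

namespace CubeComplex

variable {A X X' : CubeComplex.{u}}

theorem PathClass.conj_eq_iff {x y : X.Vertex} (k g : X.Pi1 x) (γ : PathClass y x)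
    (m : X.Pi1 y) : g * changeBase γ m * g⁻¹ = k ↔
      k.comp (g.comp γ.symm) = (g.comp γ.symm).comp m := by
  have e1 : ∀ {z} (t : PathClass x z), g.symm.comp (g.comp t) = t := fun t => by
    rw [← comp_assoc, symm_comp, refl_comp]
  have e2 : ∀ {z} (t : PathClass y z), γ.comp (γ.symm.comp t) = t := fun t => by
    rw [← comp_assoc, comp_symm, refl_comp]
  have e3 : ∀ {z} (t : PathClass x z), γ.symm.comp (γ.comp t) = t := fun t => by
    rw [← comp_assoc, symm_comp, refl_comp]
  have e4 : ∀ {z} (t : PathClass x z), g.comp (g.symm.comp t) = t := fun t => by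
    rw [← comp_assoc, comp_symm, refl_comp]
  change (g.comp ((γ.symm.comp m).comp γ)).comp g.symm = k ↔ _
  constructor
  · rintro rfl
    simp only [comp_assoc, e1]
    rw [comp_symm, comp_refl]
  · intro h
    have h' := congrArg (fun t => (t.comp γ).comp g.symm) h
    simp only [comp_assoc, e3] at h' ⊢
    rw [comp_symm, comp_refl] at h'
    exact h'.symm

/-- Turns membership in a conjugate into geometry. The vertex `u` is the base point of the
corresponding lift of the universal cover of `A`, and the conjugate moves `u` along lifts of loops
of `A`. -/
theorem _root_.CubeMap.mem_map_pi1Image_iff (f : CubeMap A X) (a : A.Vertex) {x : X.Vertex}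
    (γ : PathClass (f.toFun a) x) (g k : X.Pi1 x) {u : (univCover X x).Vertex}
    (hu : univCover.pt u = ⟨f.toFun a, g.comp γ.symm⟩) :
    k ∈ (f.pi1Image a γ).map (MulAut.conj g).toMonoidHom ↔ ∃ l, IsWalk a l a ∧
      Pt.Reach (univCover.pt u) (l.map f.toFun) (univCover.pt ((univCover.act k).toFun u)) := by
  rw [univCover.pt_act, hu]
  constructor
  · rintro ⟨_, ⟨m, rfl⟩, h⟩
    induction m using PathClass.ind with
    | h l hl =>
      exact ⟨l, hl, f.isWalk hl, (PathClass.conj_eq_iff k g γ _).1 h⟩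
  · rintro ⟨l, hl, h1, h2⟩
    exact ⟨_, ⟨PathClass.mk l hl, rfl⟩, (PathClass.conj_eq_iff k g γ _).2 h2⟩

/-- The convex subcomplex of the universal cover that belongs to a conjugate of `π₁A`. -/
theorem exists_convexSet_of_conj {f : CubeMap A X} (hf : f.IsLocalIsometry)
    {p : CubeMap X' X} (hp : p.IsCovering) (hX' : X'.IsNPC)
    (hemb : ∀ (B : CubeComplex.{u}) (q : CubeMap B A) (f' : CubeMap B X'),
      CubeMap.IsElevation f p q f' → f'.IsEmbedding)
    (a : A.Vertex) {x : X.Vertex} (γ : PathClass (f.toFun a) x)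
    {π : CubeMap (univCover X x) X'} (hπ : p.comp π = univCover.proj x) (g : X.Pi1 x) :
    ∃ (B : Set X'.Dart) (u : (univCover X x).Vertex), IsConvexSet B ∧
      (∀ k ∈ (f.pi1Image a γ).map (MulAut.conj g).toMonoidHom,
        ∀ y ∈ span {d | π.toFun d ∈ B} u,
          (univCover.act k).toFun y ∈ span {d | π.toFun d ∈ B} u) ∧
      (∀ k, π.toFun ((univCover.act k).toFun u) = π.toFun u →
        (univCover.act k).toFun u ∈ span {d | π.toFun d ∈ B} u →
        k ∈ (f.pi1Image a γ).map (MulAut.conj g).toMonoidHom) := by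
  obtain ⟨u, hu⟩ := univCover.pt_surjective (⟨f.toFun a, g.comp γ.symm⟩ : Pt x)
  have hπ' : ∀ {n : ℕ} (c : (univCover X x).cube n),
      p.toFun (π.toFun c) = (univCover.proj x).toFun c := fun c => CubeMap.congr_toFun hπ c
  have hmap : ∀ l : List (univCover X x).Dart,
      (l.map π.toFun).map p.toFun = l.map (univCover.proj x).toFun := by
    intro l
    rw [List.map_map]
    exact List.map_congr_left fun d _ => hπ' d
  obtain ⟨B, hB, h1, h2⟩ := CubeMap.exists_convexSet_of_elevation hf hp hX' hemb a (π.toFun u)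
    (by rw [hπ', ← univCover.pt_fst, hu])
  refine ⟨B, u, hB, ?_, ?_⟩
  · rintro k hk y ⟨m, hm, hmB⟩
    rw [f.mem_map_pi1Image_iff a γ g k hu] at hk
    obtain ⟨l, hl, hr⟩ := hk
    obtain ⟨t, ht, ht'⟩ := univCover.exists_walk_of_reach hr
    obtain ⟨l', a', hl', e, -⟩ := h2 (π.isWalk hm) (by
      intro d hd
      rw [List.mem_map] at hd
      obtain ⟨d', hd', rfl⟩ := hd
      exact hmB d' hd')
    have hw : IsWalk u (t ++ m.map (univCover.act k).toFun) ((univCover.act k).toFun y) :=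
      (isWalk_append _ _).2 ⟨_, ht, (univCover.act k).isWalk hm⟩
    refine ⟨_, hw, fun d hd => ?_⟩
    refine h1 ((isWalk_append _ _).2 ⟨_, hl, hl'⟩) (π.isWalk hw) ?_ _ (List.mem_map_of_mem hd)
    rw [hmap, List.map_append, List.map_append, ht', e, hmap, List.map_map]
    rfl
  · rintro k hk ⟨m, hm, hmB⟩
    obtain ⟨l, a', hl, e, ha⟩ := h2 (π.isWalk hm) (by
      intro d hd
      rw [List.mem_map] at hd
      obtain ⟨d', hd', rfl⟩ := hd
      exact hmB d' hd')
    obtain rfl := ha hk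
    rw [f.mem_map_pi1Image_iff _ γ g k hu]
    refine ⟨l, hl, ?_⟩
    rw [e, hmap]
    exact univCover.reach_walk hm

/-- By uniqueness of lifts, being a deck transformation over `X'` can be tested at a single vertex.
-/
theorem univCover.comp_act_eq {p : CubeMap X' X} (hp : p.IsCovering) {x : X.Vertex}
    {π : CubeMap (univCover X x) X'} (hπ : p.comp π = univCover.proj x) {k : X.Pi1 x}
    {v : (univCover X x).Vertex} (h : π.toFun ((act k).toFun v) = π.toFun v) :
    π.comp (act k) = π := by
  refine hp.lift_unique (isSimplyConnected x).1 ?_ (z := v) h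
  ext n c
  exact (CubeMap.congr_toFun hπ ((act k).toFun c)).trans (CubeMap.congr_toFun hπ c).symm

theorem finite_cube_of_hasFiniteFibres {p : CubeMap X' X} (hp : p.IsCovering)
    (hfin : p.HasFiniteFibres) (hX : X.IsCompactComplex) (n : ℕ) : Finite (X'.cube n) := by
  have hc : ∀ n, Finite (X.cube n) := fun n =>
    haveI : Finite (Σ n, X.cube n) := hX
    Finite.of_injective (fun c : X.cube n => (⟨n, c⟩ : Σ n, X.cube n)) fun a b h => by simpa using h
  have := hc n
  have := hc 0
  have hV : Finite X'.Vertex := by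
    rw [← Set.finite_univ_iff]
    refine (Set.finite_iUnion fun x : X.Vertex => hfin x).subset fun y _ => ?_
    rw [Set.mem_iUnion]
    exact ⟨p.toFun y, rfl⟩
  refine Finite.of_injective (fun c : X'.cube n => ((p.toFun c, origin c) : X.cube n × X'.Vertex)) ?_
  intro c c' h
  simp only [Prod.mk.injEq] at h
  exact hp.eq_of_eq h.2 h.1

end CubeComplex

/-! ### Counting conjugacy classes by a finite invariant -/

theorem Set.finite_image_of_finite_invariant {α β τ : Type*} [Finite τ] (S : Set α) (F : α → β)
    (R : α → τ → Prop) (hex : ∀ a ∈ S, ∃ t, R a t)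
    (huni : ∀ a ∈ S, ∀ b ∈ S, ∀ t, R a t → R b t → F a = F b) : (F '' S).Finite := by
  have : ∀ y : F '' S, ∃ t, ∃ a ∈ S, F a = y ∧ R a t := by
    rintro ⟨_, a, ha, rfl⟩
    obtain ⟨t, ht⟩ := hex a ha
    exact ⟨t, a, ha, rfl, ht⟩
  choose t ht using this
  refine Set.finite_coe_iff.1 (Finite.of_injective t ?_)
  intro y z h
  obtain ⟨a, ha, h1, h2⟩ := ht y
  obtain ⟨b, hb, h3, h4⟩ := ht z
  rw [h] at h2
  exact Subtype.ext (h1.symm.trans ((huni a ha b hb _ h2 h4).trans h3))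

theorem Subgroup.conjClass_eq {G : Type*} [Group G] {H K K' : Subgroup G} {h : G} (hh : h ∈ H)
    (e : K' = K.map (MulAut.conj h).toMonoidHom) :
    {L : Subgroup G | ∃ t ∈ H, L = K.map (MulAut.conj t).toMonoidHom}
      = {L : Subgroup G | ∃ t ∈ H, L = K'.map (MulAut.conj t).toMonoidHom} := by
  have comp : ∀ s t : G, (K.map (MulAut.conj t).toMonoidHom).map (MulAut.conj s).toMonoidHom
      = K.map (MulAut.conj (s * t)).toMonoidHom := by
    intro s t
    rw [Subgroup.map_map, map_mul]
    rfl
  subst e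
  ext L
  constructor
  · rintro ⟨t, ht, rfl⟩
    exact ⟨t * h⁻¹, H.mul_mem ht (H.inv_mem hh), by rw [comp, inv_mul_cancel_right]⟩
  · rintro ⟨t, ht, rfl⟩
    exact ⟨t * h, H.mul_mem ht hh, comp _ _⟩

namespace CubeComplex

open univCover

variable {X X' : CubeComplex.{u}} {x : X.Vertex}

/-- The convex set `Q` and the vertex `v` determine the subgroup `K` up to finite index: `K`
stabilizes the subcomplex of the universal cover spanned by `Q` and `v`, and contains all
deck transformations over `X'` with this property. -/
structure IsCarriedBy (π : CubeMap (univCover X x) X') (K : Subgroup (X.Pi1 x)) (Q : Set X'.Dart)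
    (v : (univCover X x).Vertex) : Prop where
  convex : IsConvexSet Q
  act_mem : ∀ k ∈ K, ∀ y ∈ span {d | π.toFun d ∈ Q} v, (act k).toFun y ∈ span {d | π.toFun d ∈ Q} v
  mem : ∀ k, π.comp (act k) = π → (act k).toFun v ∈ span {d | π.toFun d ∈ Q} v → k ∈ K

/-- By `hT`, some `k' ∈ K'` moves `v'` to a vertex over the same vertex of `X'` as `kv`. Then
`gkg⁻¹k'⁻¹` is a deck transformation over `X'` that preserves the component of `v'`, so it lies in
`K'`. -/
theorem IsCarriedBy.conj_mem {p : CubeMap X' X} (hp : p.IsCovering)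
    {π : CubeMap (univCover X x) X'} (hπ : p.comp π = proj x) {K K' : Subgroup (X.Pi1 x)}
    {Q : Set X'.Dart} {v v' : (univCover X x).Vertex} (h : IsCarriedBy π K Q v)
    (h' : IsCarriedBy π K' Q v') {g : X.Pi1 x} (hg : (act g).toFun v = v')
    (hgd : π.comp (act g) = π)
    (hT : ∀ k ∈ K, ∃ k' ∈ K', π.toFun ((act k').toFun v') = π.toFun ((act k).toFun v))
    {k : X.Pi1 x} (hk : k ∈ K) : g * k * g⁻¹ ∈ K' := by
  have hD := π.isConvexSet_preimage h.convex
  obtain ⟨k', hk', e⟩ := hT k hk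
  have e1 : (act (g * k * g⁻¹ * k'⁻¹)).toFun ((act k').toFun v')
      = (act g).toFun ((act k).toFun v) := by
    rw [act_mul, act_inv_act, act_mul, act_mul, ← hg, act_inv_act]
  have hd : π.comp (act (g * k * g⁻¹ * k'⁻¹)) = π := by
    refine comp_act_eq hp hπ (v := (act k').toFun v') ?_
    rw [e1, e]
    exact CubeMap.congr_toFun hgd _
  have m1 := h'.act_mem k' hk' v' (mem_span_self _ _)
  have m2 := map_mem_span hgd (h.act_mem k hk v (mem_span_self _ _))
  have m3 := map_mem_span hd (hD.mem_span_symm m1)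
  rw [hg] at m2
  rw [e1] at m3
  have := K'.mul_mem (h'.mem _ hd (mem_span_trans m2 m3)) hk'
  rwa [inv_mul_cancel_right] at this

end CubeComplex

theorem mainTheorem5 {n : ℕ} (X : CubeComplex.{u}) (hX : X.IsNPC) (hXcpt : X.IsCompactComplex)
    (hXconn : X.IsConnected)
    (A : Fin n → CubeComplex.{u}) (hA : ∀ i, (A i).IsNPC) (hAcpt : ∀ i, (A i).IsCompactComplex)
    (hAconn : ∀ i, (A i).IsConnected)
    (f : ∀ i, CubeMap (A i) X) (hf : ∀ i, (f i).IsLocalIsometry)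
    (hcover : ∃ (X' : CubeComplex.{u}) (p : CubeMap X' X),
      X'.IsConnected ∧ p.IsCovering ∧ p.HasFiniteFibres ∧
      X'.HasEmbeddedCarriers ∧
      ∀ (i : Fin n) (B : CubeComplex.{u}) (q : CubeMap B (A i)) (f' : CubeMap B X'),
        CubeMap.IsElevation (f i) p q f' → f'.IsEmbedding)
    (x : X.Vertex) (a : ∀ i, (A i).Vertex)
    (γ : ∀ i, CubeComplex.PathClass ((f i).toFun (a i)) x) :
    FiniteStature (fun i => (f i).pi1Image (a i) (γ i)) := by
  obtain ⟨X', p, hX'conn, hp, hfin, hcarr, hemb⟩ := hcover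
  have hX' := hp.isNPC hX
  have hos := hasNoSelfOsculation hX' hcarr
  have hs := univCover.isSimplyConnected x
  have hcov : (univCover.proj x).IsCovering := univCover.isCovering
  obtain ⟨x', hx'⟩ := hp.surjective hX'conn hXconn x
  obtain ⟨y₀, hy₀⟩ := univCover.pt_surjective (⟨x, PathClass.refl x⟩ : Pt x)
  obtain ⟨π, hπ, -⟩ := hp.exists_lift_map hs (univCover.proj x) y₀ x'
    (by rw [← univCover.pt_fst, hy₀, hx'])
  have hπc : π.IsCovering := hp.of_comp hcov hπ
  have : Finite X'.Dart := finite_cube_of_hasFiniteFibres hp hfin hXcpt 1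
  have : Finite X'.Vertex := finite_cube_of_hasFiniteFibres hp hfin hXcpt 0
  have data := fun (g : X.Pi1 x) (j : Fin n) =>
    exists_convexSet_of_conj (hf j) hp hX' (hemb j) (a j) (γ j) hπ g
  choose B u hB hB1 hB2 using data
  intro i
  have hone : ((f i).pi1Image (a i) (γ i)).map (MulAut.conj (1 : X.Pi1 x)).toMonoidHom
      = (f i).pi1Image (a i) (γ i) := by
    rw [map_one]
    exact Subgroup.map_id _
  -- Any vertex of the subcomplex of `H` may serve as its base point for deck transformations over
  -- `X'`.
  have hΩ : ∀ {w k}, w ∈ span {d | π.toFun d ∈ B 1 i} (u 1 i) → π.comp (univCover.act k) = π →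
      (univCover.act k).toFun w ∈ span {d | π.toFun d ∈ B 1 i} (u 1 i) →
      k ∈ (f i).pi1Image (a i) (γ i) := by
    intro w k hw hk h
    rw [← hone]
    refine hB2 1 i k (CubeMap.congr_toFun hk _) (mem_span_trans h (map_mem_span hk ?_))
    exact (π.isConvexSet_preimage (hB 1 i)).mem_span_symm hw
  -- The invariant of `K` consists of the convex set `Q`, the image of `v` and the image of the
  -- orbit `Kv`, all in the finite complex `X'`.
  refine Set.finite_image_of_finite_invariant (τ := Set X'.Dart × X'.Vertex × Set X'.Vertex) _ _
    (fun K t => ∃ v ∈ span {d | π.toFun d ∈ B 1 i} (u 1 i), IsCarriedBy π K t.1 v ∧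
      π.toFun v = t.2.1 ∧ (fun k => π.toFun ((univCover.act k).toFun v)) '' (K : Set (X.Pi1 x))
        = t.2.2) ?_ ?_
  · rintro K ⟨-, S, rfl⟩
    set K := (f i).pi1Image (a i) (γ i) ⊓
      ⨅ s ∈ S, ((f s.2).pi1Image (a s.2) (γ s.2)).map (MulAut.conj s.1).toMonoidHom with hK
    have hKs : ∀ s ∈ S, ∀ k ∈ K,
        k ∈ ((f s.2).pi1Image (a s.2) (γ s.2)).map (MulAut.conj s.1).toMonoidHom := by
      intro s hs k hk
      exact (Subgroup.mem_iInf.1 (Subgroup.mem_iInf.1 hk.2 s) hs)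
    -- The candidates form a subset of a finite power set, so a minimal one exists even if `S` is
    -- infinite. The vertex `v` may vary with `Q`, because passing to a parallel part moves it.
    let 𝒬 : Set (Set X'.Dart) := {Q | IsConvexSet Q ∧ Q ⊆ B 1 i ∧
      ∃ v ∈ span {d | π.toFun d ∈ B 1 i} (u 1 i), ∀ k ∈ K, ∀ y ∈ span {d | π.toFun d ∈ Q} v,
        (univCover.act k).toFun y ∈ span {d | π.toFun d ∈ Q} v}
    have hne : 𝒬.Nonempty := ⟨B 1 i, hB 1 i, subset_rfl, u 1 i, mem_span_self _ _,
      fun k hk y hy => hB1 1 i k (hone.symm ▸ hk.1) y hy⟩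
    obtain ⟨Q, ⟨hQ, hQB, v, hv, hinv⟩, hmin⟩ := (Set.toFinite 𝒬).exists_minimal hne
    have hQD := π.isConvexSet_preimage hQ
    have hsub : span {d | π.toFun d ∈ Q} v ⊆ span {d | π.toFun d ∈ B 1 i} (u 1 i) :=
      fun y hy => mem_span_trans hv (span_mono (Set.preimage_mono (f := π.toFun) hQB) v hy)
    refine ⟨(Q, π.toFun v, _), v, hv, ⟨hQ, hinv, fun k hk hkv => ?_⟩, rfl, rfl⟩
    refine ⟨hΩ hv hk (hsub hkv), ?_⟩
    refine Subgroup.mem_iInf.2 fun s => Subgroup.mem_iInf.2 fun hs' => ?_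
    obtain ⟨Q₂, hQ₂, hQ₂c, v₂, hv₂, h1, h2⟩ :=
      exists_parallel_part hπc hX' hs hos hQ (hB s.1 s.2) v (u s.1 s.2)
    have hmem : Q₂ ∈ 𝒬 := ⟨hQ₂c, hQ₂.trans hQB, v₂, hsub hv₂, fun k hk =>
      h1 _ (hinv k hk) (hB1 s.1 s.2 k (hKs s hs' k hk))⟩
    -- By minimality the whole component of `Q` is parallel into the subcomplex of this conjugate,
    -- so deck transformations over `X'` that preserve the component lie in the conjugate.
    obtain rfl : Q₂ = Q := le_antisymm hQ₂ (hmin hmem hQ₂)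
    refine hB2 s.1 s.2 k (CubeMap.congr_toFun hk _) (h2 _ hk ?_)
    exact mem_span_trans (mem_span_trans (hQD.mem_span_symm hv₂) hkv) (map_mem_span hk hv₂)
  · rintro K - K' - ⟨Q, z, T⟩ ⟨v, hv, hK, rfl, rfl⟩ ⟨v', hv', hK', hvv, hT⟩
    obtain ⟨g, hg⟩ := univCover.exists_act_eq (v := v) (w := v') (by
      rw [← CubeMap.congr_toFun hπ v, ← CubeMap.congr_toFun hπ v']
      exact congrArg p.toFun hvv.symm)
    have hg' : (univCover.act g⁻¹).toFun v' = v := by rw [← hg, univCover.act_inv_act]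
    have hgd : π.comp (univCover.act g) = π :=
      univCover.comp_act_eq hp hπ (v := v) (by rw [hg, hvv])
    have hgd' : π.comp (univCover.act g⁻¹) = π :=
      univCover.comp_act_eq hp hπ (v := v') (by rw [hg', hvv])
    -- The conjugating element lies in `H`, since it moves the vertex `v` of the subcomplex of `H`
    -- to the vertex `v'` of the same subcomplex.
    refine Subgroup.conjClass_eq (hΩ hv hgd (hg.symm ▸ hv')) ?_
    ext k
    constructor
    · intro hk
      refine ⟨g⁻¹ * k * g, ?_, by simp [mul_assoc]⟩
      have := hK'.conj_mem hp hπ hK hg' hgd'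
        (fun k hk => hT.subset ⟨k, hk, rfl⟩) hk
      rwa [inv_inv] at this
    · rintro ⟨k, hk, rfl⟩
      exact hK.conj_mem hp hπ hK' hg hgd (fun k hk => hT.superset ⟨k, hk, rfl⟩) hk
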